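/- **Setting.** Let $d\in\mathbb N$, $\beta\in\mathbb R^d$, and for a sample size $n$ let $$Y = X\beta+\epsilon+o\in\mathbb R^n,$$ where $X\in\mathbb R^{n\times d}$ is a (deterministic or random) design matrix, $\epsilon\in\mathbb R^n$ is random noise independent of $X$, $G_n\subseteq\{1,\dots,n\}$ is the set of potential outliers, and $o\in\mathbb R^n$ satisfies $o_i=0$ for all $i\notin G_n$. The adversary is arbitrary: $G_n$ and $o$ may be random and may depend in any way on $X$ and $\epsilon$. The number $c_n\in\mathbb N$ is known and $|G_n|\le c_n$ always; put $a_n:=n-c_n$. For $S\subseteq\{1,\dots,n\}$, the index $S$ denotes the restriction to the rows in $S$. Let $$\hat\beta^S_{\mathrm{OLS}}:=(X_S^\top X_S)^{+}X_S^\top Y_S$$ with the Moore–Penrose inverse ${}^+$, let $\lambda_{\min}$ be the smallest eigenvalue, let $\|\cdot\|_2$ be the Euclidean norm of vectors and the spectral norm of matrices, and let $V(S):=(S\cup G_n^{\mathsf c})\setminus(G_n^{\mathsf c}\cap S)$. **Torrent** with threshold parameter $a$. For $v\in\mathbb R^n$ let $\mathrm{HT}(v,a)$ be the set of the indices of the $a$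 smallest entries of $v$, where ties are broken by a fixed deterministic rule (any such rule). Start with $S_0=\{1,\dots,n\}$ and $r_0=\|Y\|_2$. For $t=1,2,\dots$ put $$\hat\beta^t=\hat\beta^{S_{t-1}}_{\mathrm{OLS}},\qquad S_t=\mathrm{HT}\bigl(|Y-X\hat\beta^t|,a\bigr),\qquad r_t=\|Y_{S_t}-X_{S_t}\hat\beta^t\|_2,$$ and stop at the first $t\ge 1$ for which $r_t<r_{t-1}$ fails (such a $t$ exists). The output is $\hat\beta^{n,a}_{\mathrm{Tor}}:=\hat\beta^t$ for this $t$. **Assumption on the noise.** The components $\epsilon_1,\dots,\epsilon_n$ are i.i.d. with mean zero and sub-Gaussian with variance proxy $\sigma^2$, $\sigma\ge 0$, that is, $\mathbb E\,e^{s\epsilon_i}\le e^{\sigma^2s^2/2}$ for all $s\in\mathbb R$. Define $$\eta:=\max_{|S|=a_n}\frac{\|X_{V(S)}\|_2}{\sqrt{\lambda_{\min}(X_S^\top X_S)}},\qquad \lambda_{a_n}(X):=\min_{|S|=a_n}\sqrt{\lambda_{\min}(X_S^\top X_S)} .$$ **Corollary 3.4.** 1. There exists a universal constant $K>0$ such that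 the following holds. Let $1\le c_n<n/2$, and assume that, almost surely, $\lambda_{\min}(X_S^\top X_S)>0$ for all $S$ with $|S|=a_n$ and $\eta<1/\sqrt2$. Then for all $\delta>0$, with probability at least $1-\delta$, $$\bigl\|\hat\beta^{n,a_n}_{\mathrm{Tor}}-\beta\bigr\|_2\le \frac{\sigma}{\lambda_{a_n}(X)}\Bigl(1+\frac{\sqrt2}{1-\sqrt2\,\eta}\Bigr)\Bigl(\sqrt d+\sqrt{2c_nK\log\tfrac{2en}{c_n\delta}}\Bigr)+\frac{2\sigma\sqrt{c_n}\,\Bigl(1+\sqrt{K\log\tfrac{2en}{c_n\delta}}\Bigr)}{\lambda_{a_n}(X)\,(1-\sqrt2\,\eta)} .$$ 2. Fix $d$, $\beta$ and $\sigma$, and consider the setting for every $n\in\mathbb N$, with the above assumption on the noise, but without any assumption on $\eta$. If, for each $n$, the rows of $X$ are i.i.d. standard Gaussian random vectors in $\mathbb R^d$, and $c_n\in o(n/\log n)$, then $\hat\beta^{n,a_n}_{\mathrm{Tor}}$ is consistent, that is, $\hat\beta^{n,a_n}_{\mathrm{Tor}}\to\beta$ in probability as $n\to\infty$. -/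

import Mathlib

open MeasureTheory ProbabilityTheory Filter Topology
open scoped Matrix NNReal

universe u v

noncomputable section

namespace Torrent

/-- The Penrose equations: `B` is the Moore-Penrose inverse of the real matrix `A`. -/
structure IsMoorePenrose {m n : Type*} [Fintype m] [Fintype n]
    (A : Matrix m n ℝ) (B : Matrix n m ℝ) : Prop where
  mul_mul_left : A * B * A = A
  mul_mul_right : B * A * B = B
  transpose_left : (A * B)ᵀ = A * B
  transpose_right : (B * A)ᵀ = B * A

theorem IsMoorePenrose.unique {m n : Type*} [Fintype m] [Fintype n]
    {A : Matrix m n ℝ} {B C : Matrix n m ℝ} (hB : IsMoorePenrose A B) (hC : IsMoorePenrose A C) :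
    B = C := by
  have h1 : A * B = A * C := by
    have e1 : A * C * (A * B) = A * B := by rw [← Matrix.mul_assoc, hC.mul_mul_left]
    have e2 : A * B * (A * C) = A * C := by rw [← Matrix.mul_assoc, hB.mul_mul_left]
    have e3 := congrArg Matrix.transpose e1
    rw [Matrix.transpose_mul, hB.transpose_left, hC.transpose_left, e2] at e3
    exact e3.symm
  have h2 : B * A = C * A := by
    have e1 : B * A * (C * A) = B * A := by
      rw [Matrix.mul_assoc B, ← Matrix.mul_assoc A, hC.mul_mul_left]
    have e2 : C * A * (B * A) = C * A := by
      rw [Matrix.mul_assoc C, ← Matrix.mul_assoc A, hB.mul_mul_left]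
    have e3 := congrArg Matrix.transpose e1
    rw [Matrix.transpose_mul, hB.transpose_right, hC.transpose_right, e2] at e3
    exact e3.symm
  calc B = B * A * B := hB.mul_mul_right.symm
    _ = C * A * B := by rw [h2]
    _ = C * (A * B) := by rw [Matrix.mul_assoc]
    _ = C * (A * C) := by rw [h1]
    _ = C := by rw [← Matrix.mul_assoc, hC.mul_mul_right]

/-- Every real symmetric matrix has a Moore-Penrose inverse. -/
theorem exists_isMoorePenrose {n : Type*} [Fintype n] [DecidableEq n]
    (A : Matrix n n ℝ) (hA : A.IsHermitian) : ∃ B, IsMoorePenrose A B := by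
  obtain ⟨U, D, hU, hAD⟩ : ∃ (U : Matrix n n ℝ) (D : n → ℝ), Uᵀ * U = 1 ∧
      A = U * Matrix.diagonal D * Uᵀ := by
    refine ⟨hA.eigenvectorUnitary, hA.eigenvalues, ?_, ?_⟩
    · simpa [Matrix.star_eq_conjTranspose] using Unitary.coe_star_mul_self hA.eigenvectorUnitary
    · have h := hA.spectral_theorem
      rw [Unitary.conjStarAlgAut_apply] at h
      simpa [Matrix.star_eq_conjTranspose, Function.comp_def] using h
  have key : ∀ D E : n → ℝ, (U * Matrix.diagonal D * Uᵀ) * (U * Matrix.diagonal E * Uᵀ)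
      = U * Matrix.diagonal (fun i => D i * E i) * Uᵀ := by
    intro D E
    rw [← Matrix.diagonal_mul_diagonal]
    calc _ = U * Matrix.diagonal D * (Uᵀ * U) * Matrix.diagonal E * Uᵀ := by
          simp only [Matrix.mul_assoc]
      _ = _ := by rw [hU]; simp only [Matrix.mul_assoc, Matrix.one_mul]
  have symm : ∀ D : n → ℝ, (U * Matrix.diagonal D * Uᵀ)ᵀ = U * Matrix.diagonal D * Uᵀ := by
    intro D
    simp [Matrix.transpose_mul, Matrix.mul_assoc]
  subst hAD
  refine ⟨U * Matrix.diagonal (fun i => (D i)⁻¹) * Uᵀ, ?_, ?_, ?_, ?_⟩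
  · rw [key, key]; congr 3; ext i; by_cases h : D i = 0 <;> simp [h]
  · rw [key, key]; congr 3; ext i; by_cases h : D i = 0 <;> simp [h]
  · rw [key, symm]
  · rw [key, symm]

open Classical in
/-- The Moore-Penrose inverse `A⁺` (unique by `IsMoorePenrose.unique`; it exists for the symmetric
matrices to which it is applied below by `exists_isMoorePenrose`). -/
def pinv {m n : Type*} [Fintype m] [Fintype n] (A : Matrix m n ℝ) : Matrix n m ℝ :=
  if h : ∃ B, IsMoorePenrose A B then h.choose else 0

variable {n d : ℕ}

/-- The submatrix `X_S` of the rows of `X` with indices in `S`. -/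
def rows (X : Matrix (Fin n) (Fin d) ℝ) (S : Finset (Fin n)) : Matrix S (Fin d) ℝ :=
  X.submatrix Subtype.val id

/-- `X_Sᵀ X_S`. -/
def gram (X : Matrix (Fin n) (Fin d) ℝ) (S : Finset (Fin n)) : Matrix (Fin d) (Fin d) ℝ :=
  (rows X S)ᵀ * rows X S

/-- The Euclidean norm `‖v_S‖₂` of the subvector of `v` with indices in `S`. -/
def norm2On (v : Fin n → ℝ) (S : Finset (Fin n)) : ℝ :=
  ‖(WithLp.toLp 2 (fun i : S => v i) : EuclideanSpace ℝ S)‖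

/-- The ordinary-least-squares estimator `(X_Sᵀ X_S)⁺ X_Sᵀ Y_S` on the data with indices in `S`. -/
def ols (X : Matrix (Fin n) (Fin d) ℝ) (Y : Fin n → ℝ) (S : Finset (Fin n)) :
    EuclideanSpace ℝ (Fin d) :=
  WithLp.toLp 2 (pinv (gram X S) *ᵥ ((rows X S)ᵀ *ᵥ fun i : S => Y i))

/-- The residual vector `Y - X b`. -/
def residual (X : Matrix (Fin n) (Fin d) ℝ) (Y : Fin n → ℝ) (b : EuclideanSpace ℝ (Fin d)) :
    Fin n → ℝ :=
  Y - X *ᵥ b.ofLp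

/-- A deterministic rule that sorts every vector of `ℝⁿ` increasingly, that is, a sorting
permutation together with a fixed way to break ties. -/
structure SortRule (n : ℕ) where
  perm : (Fin n → ℝ) → Equiv.Perm (Fin n)
  monotone : ∀ v : Fin n → ℝ, Monotone (v ∘ perm v)

/-- Breaking ties by the index gives a sorting rule. -/
def SortRule.byIndex (n : ℕ) : SortRule n where
  perm v := Tuple.sort v
  monotone v := Tuple.monotone_sort v

/-- Hard thresholding: the indices of the `a` smallest entries of `v`. -/
def HT (R : SortRule n) (v : Fin n → ℝ) (a : ℕ) : Finset (Fin n) :=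
  (Finset.univ.filter fun i : Fin n => (i : ℕ) < a).image (R.perm v)

/-- The set selected by one pass of the loop of Torrent from the current set `S`. -/
def torrentStep (R : SortRule n) (X : Matrix (Fin n) (Fin d) ℝ) (Y : Fin n → ℝ) (a : ℕ)
    (S : Finset (Fin n)) : Finset (Fin n) :=
  HT R (fun i => |residual X Y (ols X Y S) i|) a

/-- The active set `S_t`, where `S_0` consists of all indices. -/
def torrentSet (R : SortRule n) (X : Matrix (Fin n) (Fin d) ℝ) (Y : Fin n → ℝ) (a : ℕ) :
    ℕ → Finset (Fin n)
  | 0 => Finset.univ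
  | t + 1 => torrentStep R X Y a (torrentSet R X Y a t)

/-- The value of `‖e‖₂` after `t` passes of the loop: `‖Y‖₂` for `t = 0`, and
`‖Y_{S_t} - X_{S_t} β̂ᵗ‖₂` with `β̂ᵗ = ols X Y S_{t-1}` for `t ≥ 1`. -/
def torrentErr (R : SortRule n) (X : Matrix (Fin n) (Fin d) ℝ) (Y : Fin n → ℝ) (a : ℕ) : ℕ → ℝ
  | 0 => norm2On Y Finset.univ
  | t + 1 => norm2On (residual X Y (ols X Y (torrentSet R X Y a t))) (torrentSet R X Y a (t + 1))

/-- The loop stops: at some point the error does not decrease strictly any more. -/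
theorem torrent_stops (R : SortRule n) (X : Matrix (Fin n) (Fin d) ℝ) (Y : Fin n → ℝ) (a : ℕ) :
    ∃ t, ¬ torrentErr R X Y a (t + 1) < torrentErr R X Y a t := by
  by_contra! h
  have hanti : StrictAnti (torrentErr R X Y a) := strictAnti_nat_of_succ_lt h
  refine not_injective_infinite_finite (torrentSet R X Y a) fun s t hst => ?_
  have e : torrentErr R X Y a (s + 1) = torrentErr R X Y a (t + 1) := by
    simp only [torrentErr, torrentSet, hst]
  exact Nat.succ_injective (hanti.injective e)

open Classical in
/-- The output `β̂` of Torrent with threshold parameter `a`. The first pass is always carried out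
(there the error is compared with `∞`); the loop ends after pass `T + 1` for the least `T` such that
the error after pass `T + 1` is not smaller than the one before it, and the estimate computed in
pass `T + 1` is returned. -/
def torrent (R : SortRule n) (X : Matrix (Fin n) (Fin d) ℝ) (Y : Fin n → ℝ) (a : ℕ) :
    EuclideanSpace ℝ (Fin d) :=
  ols X Y (torrentSet R X Y a (Nat.find (torrent_stops R X Y a)))

/-- The smallest eigenvalue of a symmetric matrix. -/
def lamMin (A : Matrix (Fin d) (Fin d) ℝ) : ℝ := sInf (spectrum ℝ A)

open scoped Matrix.Norms.L2Operator in
/-- The spectral norm (the operator norm for the Euclidean norms). -/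
def specNorm {m : Type*} [Fintype m] [DecidableEq m] (A : Matrix m (Fin d) ℝ) : ℝ := ‖A‖

/-- `V(S)`, the symmetric difference of `S` and the set `Gᶜ` of inliers. -/
def symDiff (G S : Finset (Fin n)) : Finset (Fin n) := (S ∪ Gᶜ) \ (Gᶜ ∩ S)

/-- `η = max_{|S| = a} ‖X_{V(S)}‖₂ / √(λ_min(X_Sᵀ X_S))`. -/
def eta (X : Matrix (Fin n) (Fin d) ℝ) (G : Finset (Fin n)) (a : ℕ) : ℝ :=
  ⨆ S : {S : Finset (Fin n) // S.card = a},
    specNorm (rows X (symDiff G S)) / √(lamMin (gram X S))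

/-- `λ_a(X) = min_{|S| = a} √(λ_min(X_Sᵀ X_S))`. -/
def lam (X : Matrix (Fin n) (Fin d) ℝ) (a : ℕ) : ℝ :=
  ⨅ S : {S : Finset (Fin n) // S.card = a}, √(lamMin (gram X S))

/-- The condition `η < 1/√2`, which includes that no denominator in the definition of `η`
vanishes. -/
def EtaCondition (X : Matrix (Fin n) (Fin d) ℝ) (G : Finset (Fin n)) (a : ℕ) : Prop :=
  (∀ S : Finset (Fin n), S.card = a → 0 < lamMin (gram X S)) ∧ eta X G a < 1 / √2

/-- The response `Y = X β + ε + o` of the linear model with outliers. -/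
def response (X : Matrix (Fin n) (Fin d) ℝ) (β : EuclideanSpace ℝ (Fin d)) (ε o : Fin n → ℝ) :
    Fin n → ℝ :=
  X *ᵥ β.ofLp + ε + o

/-- The components of the random vector `ε` are i.i.d. with mean zero and sub-Gaussian with variance
proxy `σ²`, that is, `𝔼 exp(s εᵢ) ≤ exp(σ² s² / 2)` for all real `s`. -/
structure IsSubGaussianNoise {Ω : Type*} [MeasurableSpace Ω] (ε : Ω → Fin n → ℝ) (σ : ℝ≥0)
    (μ : Measure Ω) : Prop where
  indep : iIndepFun (fun i ω => ε ω i) μ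
  ident : ∀ i j, IdentDistrib (fun ω => ε ω i) (fun ω => ε ω j) μ μ
  mean_zero : ∀ i, ∫ ω, ε ω i ∂μ = 0
  subGaussian : ∀ i, HasSubgaussianMGF (fun ω => ε ω i) (σ ^ 2) μ

/-- The right-hand side of the error bound, with `η` and `λ` the values of `eta` and `lam`. -/
def errorBound (K σ η lam δ : ℝ) (n d c : ℕ) : ℝ :=
  σ / lam * (1 + √2 / (1 - √2 * η))
      * (√d + √(2 * c * K * Real.log (2 * Real.exp 1 * n / (c * δ))))
    + 2 * σ * √c * (1 + √(K * Real.log (2 * Real.exp 1 * n / (c * δ))))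
      / (lam * (1 - √2 * η))

end Torrent

end

namespace Torrent

variable {n d : ℕ}

/-! When the loop stops, the output is the least-squares estimator of a set `S` of size `a` on which
its residual norm is no larger than on any other set of that size (`exists_torrent_eq_ols`). Nothing
else about the algorithm is used.

Put w = X(β̂ - β), so that the residual is r = ε + o - w. The normal equations give ‖w_S‖² = ⟨w,
ε⟩_S + ⟨w, o⟩_{S ∩ G}. Since |G| + |S| ≤ n, the set S ∩ G can be exchanged for equally many inliers
outside S, and optimality of S bounds r on S ∩ G by r on Gᶜ \ S, where r = ε - w. Hence the
corruption left in S is at most √2 ‖(ε - w)_V‖ with V = V(S), and ‖w_S‖ ≤ τ + √2 (‖ε_V‖ + ‖w_V‖),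
where τ bounds the correlation of ε with the columns of X_S (`norm2On_mulVec_ols_sub_le`). The term
‖w_V‖ is absorbed on the left: by η < 1/√2 in the first claim, and because |V| ≤ 2c is small in the
second.

The set S depends on the data, so the noise has to be controlled for all S and V at once. Both τ and
‖ε_V‖ are lengths of projections of ε to subspaces of dimension at most d and 2c. A Gaussian
linearisation of the square gives their tails (`measure_lt_sum_sq_le`), and union bounds cost only
the logarithm of a binomial coefficient, of order c log(n/c).

For Gaussian designs η is bypassed. Chebyshev's inequality puts XᵀX close to n times the identity,
the sub-Gaussian tail applied to the columns of X shows that small row sets carry a small part of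
it, and c log n / n → 0 makes all remaining terms vanish (`norm_torrent_sub_le`,
`measure_lt_norm_torrent_sub_le`). -/

/-! ### Norms on index sets and the normal equations. -/

theorem norm2On_sq (v : Fin n → ℝ) (S : Finset (Fin n)) :
    norm2On v S ^ 2 = ∑ i ∈ S, v i ^ 2 := by
  rw [norm2On, EuclideanSpace.norm_sq_eq, ← Finset.sum_coe_sort S]
  simp

theorem norm2On_nonneg (v : Fin n → ℝ) (S : Finset (Fin n)) : 0 ≤ norm2On v S := norm_nonneg _

theorem norm2On_add_le (v w : Fin n → ℝ) (S : Finset (Fin n)) :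
    norm2On (v + w) S ≤ norm2On v S + norm2On w S :=
  norm_add_le (WithLp.toLp 2 (fun i : S => v i)) (WithLp.toLp 2 (fun i : S => w i))

theorem norm2On_neg (v : Fin n → ℝ) (S : Finset (Fin n)) : norm2On (-v) S = norm2On v S :=
  norm_neg (WithLp.toLp 2 (fun i : S => v i))

theorem norm2On_mono (v : Fin n → ℝ) {S T : Finset (Fin n)} (h : S ⊆ T) :
    norm2On v S ≤ norm2On v T := by
  refine le_of_sq_le_sq ?_ (norm2On_nonneg v T)
  rw [norm2On_sq, norm2On_sq]
  exact Finset.sum_le_sum_of_subset_of_nonneg h fun i _ _ => sq_nonneg _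

theorem sum_mul_le_norm2On (v w : Fin n → ℝ) (S : Finset (Fin n)) :
    ∑ i ∈ S, v i * w i ≤ norm2On v S * norm2On w S := by
  refine le_of_sq_le_sq ?_ (mul_nonneg (norm2On_nonneg _ _) (norm2On_nonneg _ _))
  rw [mul_pow, norm2On_sq, norm2On_sq]
  exact Finset.sum_mul_sq_le_sq_mul_sq S v w

theorem gram_isHermitian (X : Matrix (Fin n) (Fin d) ℝ) (S : Finset (Fin n)) :
    (gram X S).IsHermitian := by
  simpa [gram] using Matrix.isHermitian_conjTranspose_mul_self (rows X S)

theorem isMoorePenrose_pinv_gram (X : Matrix (Fin n) (Fin d) ℝ) (S : Finset (Fin n)) :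
    IsMoorePenrose (gram X S) (pinv (gram X S)) := by
  have h := exists_isMoorePenrose _ (gram_isHermitian X S)
  rw [pinv, dif_pos h]
  exact h.choose_spec

/-- This makes the normal equations hold even for a singular Gram matrix A. With M = (A A⁺ - 1)
X_Sᵀ, the product M Mᵀ contains the factor (A A⁺ - 1) A = 0, and M Mᵀ = 0 forces M = 0. -/
theorem gram_mul_pinv_mul_transpose (X : Matrix (Fin n) (Fin d) ℝ) (S : Finset (Fin n)) :
    gram X S * pinv (gram X S) * (rows X S)ᵀ = (rows X S)ᵀ := by
  have h := (isMoorePenrose_pinv_gram X S).mul_mul_left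
  set B := pinv (gram X S)
  rw [← sub_eq_zero, ← Matrix.self_mul_conjTranspose_eq_zero]
  have e : gram X S * B * (rows X S)ᵀ - (rows X S)ᵀ = (gram X S * B - 1) * (rows X S)ᵀ := by
    rw [Matrix.sub_mul, Matrix.one_mul]
  rw [e, Matrix.conjTranspose_mul, ← Matrix.mul_assoc, Matrix.mul_assoc _ _ ((rows X S)ᵀᴴ)]
  have e' : (rows X S)ᵀ * (rows X S)ᵀᴴ = gram X S := by simp [gram]
  rw [e', Matrix.sub_mul, h, Matrix.one_mul, sub_self, Matrix.zero_mul]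

/-- The normal equations. -/
theorem sum_mulVec_mul_residual_ols (X : Matrix (Fin n) (Fin d) ℝ) (Y : Fin n → ℝ)
    (S : Finset (Fin n)) (b : Fin d → ℝ) :
    ∑ i ∈ S, (X *ᵥ b) i * residual X Y (ols X Y S) i = 0 := by
  have h : (rows X S)ᵀ *ᵥ (fun i : S => residual X Y (ols X Y S) i) = 0 := by
    have e : (fun i : S => residual X Y (ols X Y S) i)
        = (fun i : S => Y i) - rows X S *ᵥ (ols X Y S).ofLp := by
      ext i; simp [residual, rows, Matrix.mulVec, dotProduct]
    rw [e, Matrix.mulVec_sub, ols]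
    simp only [Matrix.mulVec_mulVec]
    rw [← Matrix.mul_assoc, ← Matrix.mul_assoc]
    change _ - (gram X S * pinv (gram X S) * (rows X S)ᵀ) *ᵥ _ = 0
    rw [gram_mul_pinv_mul_transpose, sub_self]
  have e : ∑ i ∈ S, (X *ᵥ b) i * residual X Y (ols X Y S) i
      = (rows X S *ᵥ b) ⬝ᵥ (fun i : S => residual X Y (ols X Y S) i) := by
    rw [← Finset.sum_coe_sort S]; rfl
  rw [e, ← Matrix.vecMul_transpose, ← Matrix.dotProduct_mulVec, h, dotProduct_zero]

theorem residual_eq_add (X : Matrix (Fin n) (Fin d) ℝ) (Y : Fin n → ℝ)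
    (b b' : EuclideanSpace ℝ (Fin d)) :
    residual X Y b = residual X Y b' + X *ᵥ (b' - b).ofLp := by
  simp [residual, Matrix.mulVec_sub]

/-- Pythagoras: by the normal equations the cross term in the expanded square vanishes. -/
theorem norm2On_residual_ols_le (X : Matrix (Fin n) (Fin d) ℝ) (Y : Fin n → ℝ)
    (S : Finset (Fin n)) (b : EuclideanSpace ℝ (Fin d)) :
    norm2On (residual X Y (ols X Y S)) S ≤ norm2On (residual X Y b) S := by
  refine le_of_sq_le_sq ?_ (norm2On_nonneg _ _)
  rw [norm2On_sq, norm2On_sq, residual_eq_add X Y b (ols X Y S)]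
  set w := X *ᵥ (ols X Y S - b).ofLp with hw
  have h := sum_mulVec_mul_residual_ols X Y S (ols X Y S - b).ofLp
  rw [← hw] at h
  have e : ∑ i ∈ S, (residual X Y (ols X Y S) + w) i ^ 2
      = ∑ i ∈ S, residual X Y (ols X Y S) i ^ 2
        + 2 * ∑ i ∈ S, w i * residual X Y (ols X Y S) i + ∑ i ∈ S, w i ^ 2 := by
    rw [Finset.mul_sum, ← Finset.sum_add_distrib, ← Finset.sum_add_distrib]
    refine Finset.sum_congr rfl fun i _ => ?_
    simp only [Pi.add_apply]; ring
  rw [e, h]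
  have := Finset.sum_nonneg fun i (_ : i ∈ S) => sq_nonneg (w i)
  linarith

/-! ### Hard thresholding and the set behind the output. -/

theorem card_HT (R : SortRule n) (v : Fin n → ℝ) {a : ℕ} (ha : a ≤ n) : (HT R v a).card = a := by
  rw [HT, Finset.card_image_of_injective _ (R.perm v).injective, Fin.card_filter_val_lt,
    min_eq_right ha]

theorem le_of_mem_HT (R : SortRule n) {v : Fin n → ℝ} {a : ℕ} {i j : Fin n}
    (hi : i ∈ HT R v a) (hj : j ∉ HT R v a) : v i ≤ v j := by
  simp only [HT, Finset.mem_image, Finset.mem_filter, Finset.mem_univ, true_and, not_exists,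
    not_and] at hi hj
  obtain ⟨k, hk, rfl⟩ := hi
  obtain ⟨l, rfl⟩ := (R.perm v).surjective j
  have hl : ¬ (l : ℕ) < a := fun h => hj l h rfl
  exact R.monotone v (show k ≤ l by rw [Fin.le_def]; omega)

/-- A set whose entries lie below all other entries minimises the sum. -/
theorem sum_le_sum_of_forall_le {ι : Type*} [DecidableEq ι] {f : ι → ℝ} {S T : Finset ι}
    (hcard : S.card = T.card) (h : ∀ i ∈ S, ∀ j ∉ S, f i ≤ f j) :
    ∑ i ∈ S, f i ≤ ∑ i ∈ T, f i := by
  have hc : (S \ T).card = (T \ S).card := by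
    have h1 := Finset.card_sdiff_add_card_inter S T
    have h2 := Finset.card_sdiff_add_card_inter T S
    rw [Finset.inter_comm] at h2; omega
  have key : ∑ i ∈ S \ T, f i ≤ ∑ i ∈ T \ S, f i := by
    rcases (S \ T).eq_empty_or_nonempty with he | hne
    · rw [he, Finset.card_empty, eq_comm, Finset.card_eq_zero] at hc
      rw [he, hc]
    · obtain ⟨m, hm, hmax⟩ := (S \ T).exists_max_image f hne
      calc ∑ i ∈ S \ T, f i ≤ (S \ T).card • f m := Finset.sum_le_card_nsmul _ _ _ hmax
        _ = (T \ S).card • f m := by rw [hc]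
        _ ≤ _ := Finset.card_nsmul_le_sum _ _ _ fun j hj =>
          h m (Finset.mem_sdiff.1 hm).1 j (Finset.mem_sdiff.1 hj).2
  rw [← Finset.sum_inter_add_sum_sdiff S T f, ← Finset.sum_inter_add_sum_sdiff T S f,
    Finset.inter_comm T S]
  linarith

theorem norm2On_torrentStep_le (R : SortRule n) (X : Matrix (Fin n) (Fin d) ℝ) (Y : Fin n → ℝ)
    {a : ℕ} (ha : a ≤ n) (S : Finset (Fin n)) {S' : Finset (Fin n)} (hS' : S'.card = a) :
    norm2On (residual X Y (ols X Y S)) (torrentStep R X Y a S)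
      ≤ norm2On (residual X Y (ols X Y S)) S' := by
  refine le_of_sq_le_sq ?_ (norm2On_nonneg _ _)
  rw [norm2On_sq, norm2On_sq]
  refine sum_le_sum_of_forall_le ((card_HT R _ ha).trans hS'.symm) fun i hi j hj => ?_
  exact sq_le_sq.2 (le_of_mem_HT R hi hj)

/-- Torrent returns the least-squares estimator of a set that is optimal for its own estimator. -/
theorem exists_torrent_eq_ols (R : SortRule n) (X : Matrix (Fin n) (Fin d) ℝ) (Y : Fin n → ℝ)
    {a : ℕ} (ha : a ≤ n) :
    ∃ S : Finset (Fin n), S.card = a ∧ torrent R X Y a = ols X Y S ∧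
      ∀ S' : Finset (Fin n), S'.card = a →
        norm2On (residual X Y (ols X Y S)) S ≤ norm2On (residual X Y (ols X Y S)) S' := by
  classical
  have hle : ¬ torrentErr R X Y a (Nat.find (torrent_stops R X Y a) + 1)
      < torrentErr R X Y a (Nat.find (torrent_stops R X Y a)) :=
    Nat.find_spec (torrent_stops R X Y a)
  have hout : torrent R X Y a = ols X Y (torrentSet R X Y a (Nat.find (torrent_stops R X Y a))) := by
    unfold torrent; congr!
  generalize Nat.find (torrent_stops R X Y a) = T at hle hout
  rw [not_lt] at hle
  cases T with
  | succ t =>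
    -- The active set before the last pass works: refitting on it does not increase the error, the
    -- stopping test says the last pass did not decrease the error either, and thresholding is
    -- optimal for the refitted residuals.
    refine ⟨_, card_HT R _ ha, hout, fun S' hS' => ?_⟩
    exact ((norm2On_residual_ols_le X Y (torrentSet R X Y a (t + 1)) _).trans hle).trans
      (norm2On_torrentStep_le R X Y ha _ hS')
  -- Here the output is fitted on all indices, a set of the wrong size unless a = n. If a < n,
  -- stopping at once turns out to force `Y = 0`.
  | zero =>
    simp only [torrentErr, torrentSet] at hle hout
    set r := residual X Y (ols X Y Finset.univ) with hr
    rcases ha.eq_or_lt with rfl | ha'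
    · refine ⟨Finset.univ, by simp, hout, fun S' hS' => ?_⟩
      rw [(Finset.card_eq_iff_eq_univ S').1 (by simpa using hS')]
    · have h0 : residual X Y 0 = Y := by simp [residual]
      have h1 : norm2On r Finset.univ ≤ norm2On Y Finset.univ := by
        have := norm2On_residual_ols_le X Y Finset.univ 0
        rwa [h0] at this
      set H := torrentStep R X Y a Finset.univ with hH
      have h2 : ∑ i, r i ^ 2 ≤ ∑ i ∈ H, r i ^ 2 := by
        rw [← norm2On_sq, ← norm2On_sq]
        -- The residual on `H` is at least ‖Y‖₂, which is at least the full residual. So no residual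
        -- is left outside `H`, and since `H` holds the smallest entries, none is left inside.
        exact pow_le_pow_left₀ (norm2On_nonneg _ _) (h1.trans hle) 2
      have h3 : ∀ j ∉ H, r j = 0 := by
        intro j hj
        have h4 : ∑ i ∈ insert j H, r i ^ 2 ≤ ∑ i, r i ^ 2 :=
          Finset.sum_le_sum_of_subset_of_nonneg (Finset.subset_univ _) fun i _ _ => sq_nonneg _
        rw [Finset.sum_insert hj] at h4
        have : r j ^ 2 ≤ 0 := by linarith
        exact pow_eq_zero_iff (two_ne_zero) |>.1 (le_antisymm this (sq_nonneg _))
      obtain ⟨j, hj⟩ : ∃ j, j ∉ H := by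
        by_contra! hall
        have hc : H.card = a := card_HT R _ ha
        rw [Finset.eq_univ_of_forall hall] at hc
        simp at hc; omega
      have h5 : ∀ i ∈ H, r i = 0 := by
        intro i hi
        have : |r i| ≤ |r j| := le_of_mem_HT R hi hj
        rw [h3 j hj, abs_zero] at this
        exact abs_nonpos_iff.1 this
      have h6 : norm2On r H = 0 := by
        rw [← sq_eq_zero_iff, norm2On_sq]
        exact Finset.sum_eq_zero fun i hi => by rw [h5 i hi]; simp
      have hY : Y = 0 := by
        have h7 : norm2On Y Finset.univ ^ 2 = 0 := by
          rw [sq_eq_zero_iff]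
          exact le_antisymm (hle.trans h6.le) (norm2On_nonneg _ _)
        rw [norm2On_sq, Finset.sum_eq_zero_iff_of_nonneg fun i _ => sq_nonneg _] at h7
        ext i
        exact sq_eq_zero_iff.1 (h7 i (Finset.mem_univ i))
      have hols : ∀ S, ols X Y S = 0 := by
        intro S
        have e : (fun i : S => Y i) = 0 := by ext i; simp [hY]
        rw [ols, e, Matrix.mulVec_zero, Matrix.mulVec_zero]; rfl
      refine ⟨H, card_HT R _ ha, by rw [hout, hols, hols], fun S' _ => ?_⟩
      rw [hols, h0]
      have hz : ∀ S, norm2On Y S = 0 := fun S => by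
        rw [← sq_eq_zero_iff, norm2On_sq, hY]; simp
      rw [hz, hz]

/-! ### The deterministic bound on the prediction error. -/

theorem card_symDiff_le {G S : Finset (Fin n)} {c : ℕ} (hG : G.card ≤ c)
    (hS : n ≤ S.card + c) : (symDiff G S).card ≤ 2 * c := by
  have h : symDiff G S ⊆ G ∪ Sᶜ := by
    intro i; simp only [symDiff, Finset.mem_sdiff, Finset.mem_union, Finset.mem_inter,
      Finset.mem_compl]; tauto
  have h1 := Finset.card_le_card h
  have h2 := Finset.card_union_le G Sᶜ
  have h3 : Sᶜ.card ≤ c := by rw [Finset.card_compl, Fintype.card_fin]; omega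
  omega

/-- The prediction error of the least-squares estimator of a set `S` that is optimal for it. -/
theorem norm2On_mulVec_ols_sub_le (X : Matrix (Fin n) (Fin d) ℝ) (β : EuclideanSpace ℝ (Fin d))
    (ε o : Fin n → ℝ) {G S : Finset (Fin n)} {τ : ℝ} (hτ : 0 ≤ τ) (hG : G.card + S.card ≤ n)
    (ho : ∀ i ∉ G, o i = 0)
    (hmin : ∀ S' : Finset (Fin n), S'.card = S.card →
      norm2On (residual X (response X β ε o) (ols X (response X β ε o) S)) S
        ≤ norm2On (residual X (response X β ε o) (ols X (response X β ε o) S)) S')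
    (hε : ∀ b : Fin d → ℝ, ∑ i ∈ S, (X *ᵥ b) i * ε i ≤ τ * norm2On (X *ᵥ b) S) :
    norm2On (X *ᵥ (ols X (response X β ε o) S - β).ofLp) S
      ≤ τ + √2 * (norm2On ε (symDiff G S)
        + norm2On (X *ᵥ (ols X (response X β ε o) S - β).ofLp) (symDiff G S)) := by
  set Y := response X β ε o with hY
  set b := (ols X Y S - β).ofLp with hb
  set r := residual X Y (ols X Y S) with hr
  set w := X *ᵥ b with hw
  have hres : r = ε + o - w := by
    rw [hr, hw, hb, hY]; simp only [residual, response, WithLp.ofLp_sub, Matrix.mulVec_sub]; abel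
  set H := S ∩ G with hH
  set W := Gᶜ \ S with hW
  have hdisj : Disjoint H W := by
    rw [Finset.disjoint_left]; intro i; simp [hH, hW]; tauto
  have hV : symDiff G S = H ∪ W := by
    ext i; simp only [symDiff, hH, hW, Finset.mem_sdiff, Finset.mem_union, Finset.mem_inter,
      Finset.mem_compl]; tauto
  have hne := sum_mulVec_mul_residual_ols X Y S b
  rw [← hr, ← hw, hres] at hne
  have hq : norm2On w S ^ 2 = ∑ i ∈ S, w i * ε i + ∑ i ∈ H, w i * o i := by
    have h1 : ∑ i ∈ H, w i * o i = ∑ i ∈ S, w i * o i := by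
      refine Finset.sum_subset Finset.inter_subset_left fun i hi hi' => ?_
      rw [ho i (fun h => hi' (Finset.mem_inter.2 ⟨hi, h⟩)), mul_zero]
    rw [h1, norm2On_sq, ← sub_eq_zero, ← neg_eq_zero, ← hne, ← Finset.sum_add_distrib,
      ← Finset.sum_sub_distrib, ← Finset.sum_neg_distrib]
    refine Finset.sum_congr rfl fun i _ => ?_
    simp only [Pi.sub_apply, Pi.add_apply]; ring
  have hHW : H.card ≤ W.card := by
    have h1 := Finset.card_sdiff_add_card_inter Gᶜ S
    rw [← hW] at h1
    have h2 : (Gᶜ ∩ S).card + H.card = S.card := by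
      rw [hH, Finset.inter_comm Gᶜ S, ← Finset.sdiff_eq_inter_compl]
      exact Finset.card_sdiff_add_card_inter S G
    have h3 : Gᶜ.card = n - G.card := by rw [Finset.card_compl, Fintype.card_fin]
    have h4 : G.card ≤ n := by simpa using Finset.card_le_univ G
    omega
  obtain ⟨W', hW', hW'c⟩ := Finset.exists_subset_card_eq hHW
  -- The exchange: optimality of `S` is compared with `S \ G ∪ W'`, and the common part `S \ G`
  -- cancels.
  have hrH : norm2On r H ≤ norm2On r W := by
    refine le_trans ?_ (norm2On_mono r hW')
    have hd : Disjoint (S \ G) W' := by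
      rw [Finset.disjoint_left]; intro i hi hi'
      exact (Finset.mem_sdiff.1 (hW' hi')).2 (Finset.mem_sdiff.1 hi).1
    have h1 := hmin (S \ G ∪ W') (by
      rw [Finset.card_union_of_disjoint hd, hW'c]
      exact Finset.card_sdiff_add_card_inter S G)
    have h2 := pow_le_pow_left₀ (norm2On_nonneg _ _) h1 2
    rw [norm2On_sq, norm2On_sq, Finset.sum_union hd, ← Finset.sum_inter_add_sum_sdiff S G] at h2
    refine le_of_sq_le_sq ?_ (norm2On_nonneg _ _)
    rw [norm2On_sq, norm2On_sq]
    linarith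
  have hrW : norm2On r W = norm2On (ε - w) W := by
    rw [← sq_eq_sq₀ (norm2On_nonneg _ _) (norm2On_nonneg _ _), norm2On_sq, norm2On_sq]
    refine Finset.sum_congr rfl fun i hi => ?_
    have : i ∉ G := by
      have := (Finset.mem_sdiff.1 hi).1; simpa using this
    rw [hres]; simp [ho i this]
  have hoH : norm2On o H ≤ norm2On r H + norm2On (ε - w) H := by
    have e : o = r + -(ε - w) := by rw [hres]; abel
    calc norm2On o H = norm2On (r + -(ε - w)) H := by rw [← e]
      _ ≤ _ := norm2On_add_le _ _ _
      _ = _ := by rw [norm2On_neg]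
  have hVsq : norm2On (ε - w) (symDiff G S) ^ 2
      = norm2On (ε - w) H ^ 2 + norm2On (ε - w) W ^ 2 := by
    simp only [norm2On_sq]; rw [hV, Finset.sum_union hdisj]
  -- The factor √2 comes from x + y ≤ √2 √(x² + y²), as `H` and `W` partition V(S).
  have hoV : norm2On o H ≤ √2 * norm2On (ε - w) (symDiff G S) := by
    have h1 : norm2On o H ≤ norm2On (ε - w) W + norm2On (ε - w) H := by linarith
    refine h1.trans (le_of_sq_le_sq ?_ (mul_nonneg (Real.sqrt_nonneg _) (norm2On_nonneg _ _)))
    rw [mul_pow, Real.sq_sqrt zero_le_two, hVsq]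
    nlinarith [sq_nonneg (norm2On (ε - w) W - norm2On (ε - w) H)]
  have hVle : norm2On (ε - w) (symDiff G S)
      ≤ norm2On ε (symDiff G S) + norm2On w (symDiff G S) := by
    rw [sub_eq_add_neg]
    refine (norm2On_add_le _ _ _).trans_eq ?_
    rw [norm2On_neg]
  have hoV' : norm2On o H ≤ √2 * (norm2On ε (symDiff G S) + norm2On w (symDiff G S)) :=
    hoV.trans (mul_le_mul_of_nonneg_left hVle (Real.sqrt_nonneg _))
  have h1 : ∑ i ∈ H, w i * o i ≤ norm2On w S * norm2On o H :=
    (sum_mul_le_norm2On w o H).trans (mul_le_mul_of_nonneg_right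
      (norm2On_mono w Finset.inter_subset_left) (norm2On_nonneg _ _))
  have h2 := hε b
  rw [← hw] at h2
  have h3 := norm2On_nonneg w S
  have h4 := norm2On_nonneg o H
  by_contra! hcon
  -- If the bound failed, ‖w_S‖ would be positive and could be cancelled from ‖w_S‖² ≤ (τ + ‖o_H‖)
  -- ‖w_S‖.
  have h5 : τ + norm2On o H < norm2On w S := lt_of_le_of_lt (by linarith) hcon
  have h6 : 0 < norm2On w S := lt_of_le_of_lt (by positivity) h5
  nlinarith

/-! ### Tails of projections of sub-Gaussian vectors. -/

section SubGaussian

variable {Ω κ : Type*} [MeasurableSpace Ω] {μ : Measure Ω} {ε : Ω → Fin n → ℝ} {c : ℝ≥0}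
  [Fintype κ]

theorem lintegral_exp_sum_mul_le (hind : iIndepFun (fun i ω => ε ω i) μ)
    (hsub : ∀ i, HasSubgaussianMGF (fun ω => ε ω i) c μ) (v : Fin n → ℝ) :
    ∫⁻ ω, ENNReal.ofReal (Real.exp (∑ i, v i * ε ω i)) ∂μ
      ≤ ENNReal.ofReal (Real.exp (c * (∑ i, v i ^ 2) / 2)) := by
  have hv : ∀ i, HasSubgaussianMGF (fun ω => v i * ε ω i) (‖v i‖₊ ^ 2 * c) μ := by
    intro i
    have h := (hsub i).const_mul (v i)
    refine ⟨h.integrable_exp_mul, fun t => (h.mgf_le t).trans_eq ?_⟩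
    congr 3
    change v i ^ 2 * (c : ℝ) = ‖v i‖ ^ 2 * c
    simp
  have h := HasSubgaussianMGF.sum_of_iIndepFun (s := Finset.univ)
    (X := fun i ω => v i * ε ω i)
    (hind.comp (fun i x => v i * x) fun i => measurable_const_mul _) (fun i _ => hv i)
  have h1 := h.mgf_le 1
  have h2 := h.integrable_exp_mul 1
  simp only [one_mul] at h2
  rw [← ofReal_integral_eq_lintegral_ofReal h2 (ae_of_all _ fun _ => (Real.exp_pos _).le)]
  refine ENNReal.ofReal_le_ofReal ?_
  simp only [mgf, one_mul] at h1
  refine h1.trans (Real.exp_le_exp.2 (le_of_eq ?_))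
  push_cast
  simp only [← Finset.sum_mul, Real.norm_eq_abs, sq_abs]
  ring

theorem lintegral_exp_mul_gaussianReal (t : ℝ) :
    ∫⁻ x, ENNReal.ofReal (Real.exp (t * x)) ∂(gaussianReal 0 1)
      = ENNReal.ofReal (Real.exp (t ^ 2 / 2)) := by
  rw [← ofReal_integral_eq_lintegral_ofReal (integrable_exp_mul_gaussianReal t)
    (ae_of_all _ fun _ => (Real.exp_pos _).le)]
  have := congrFun (mgf_id_gaussianReal (μ := 0) (v := 1)) t
  simp only [mgf, id] at this
  rw [this]
  simp

/-- The value is (1 - 2λ)^(-1/2) at λ = 1/4; it enters once per dimension of the projection. -/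
theorem lintegral_exp_sq_gaussianReal :
    ∫⁻ x, ENNReal.ofReal (Real.exp (1 / 4 * x ^ 2)) ∂(gaussianReal 0 1) = ENNReal.ofReal √2 := by
  rw [gaussianReal_of_var_ne_zero _ one_ne_zero,
    lintegral_withDensity_eq_lintegral_mul _ (measurable_gaussianPDF _ _) (by fun_prop)]
  have e : ∀ x : ℝ, (gaussianPDF 0 1 * fun x => ENNReal.ofReal (Real.exp (1 / 4 * x ^ 2))) x
      = ENNReal.ofReal ((√(2 * Real.pi))⁻¹ * Real.exp (-(1 / 4) * x ^ 2)) := by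
    intro x
    rw [Pi.mul_apply, gaussianPDF, ← ENNReal.ofReal_mul (gaussianPDFReal_nonneg _ _ _),
      gaussianPDFReal, mul_assoc, ← Real.exp_add]
    simp only [NNReal.coe_one, mul_one, sub_zero]
    congr 3
    ring
  simp_rw [e]
  have hint : Integrable (fun x : ℝ => (√(2 * Real.pi))⁻¹ * Real.exp (-(1 / 4) * x ^ 2)) :=
    (integrable_exp_neg_mul_sq (by norm_num)).const_mul _
  rw [← ofReal_integral_eq_lintegral_ofReal hint (ae_of_all _ fun _ => by positivity),
    integral_const_mul, integral_gaussian]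
  congr 1
  rw [← Real.sqrt_inv, ← Real.sqrt_mul (by positivity)]
  congr 1
  field_simp
  norm_num

theorem lintegral_pi_prod {f : κ → ℝ → ENNReal} (hf : ∀ k, Measurable (f k)) (ν : Measure ℝ)
    [IsProbabilityMeasure ν] :
    ∫⁻ g, ∏ k, f k (g k) ∂(Measure.pi fun _ : κ => ν) = ∏ k, ∫⁻ x, f k x ∂ν := by
  have h := lintegral_prod_eq_prod_lintegral_of_indepFun Finset.univ
    (fun k (g : κ → ℝ) => f k (g k))
    (iIndepFun_pi (μ := fun _ : κ => ν) (X := f) fun k => (hf k).aemeasurable)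
    (fun k => (hf k).comp (measurable_pi_apply k))
  rw [h]
  refine Finset.prod_congr rfl fun k _ => ?_
  exact (measurePreserving_eval (fun _ : κ => ν) k).lintegral_comp (hf k)

theorem lintegral_exp_sum_mul_gaussian (x : κ → ℝ) :
    ∫⁻ g, ENNReal.ofReal (Real.exp (∑ k, x k * g k)) ∂(Measure.pi fun _ : κ => gaussianReal 0 1)
      = ENNReal.ofReal (Real.exp (∑ k, x k ^ 2 / 2)) := by
  simp_rw [Real.exp_sum, ENNReal.ofReal_prod_of_nonneg fun _ _ => (Real.exp_pos _).le]
  rw [lintegral_pi_prod (f := fun k y => ENNReal.ofReal (Real.exp (x k * y)))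
    (fun k => by fun_prop)]
  simp_rw [lintegral_exp_mul_gaussianReal]

theorem lintegral_exp_sum_sq_gaussian :
    ∫⁻ g, ENNReal.ofReal (Real.exp (1 / 4 * ∑ k, g k ^ 2))
      ∂(Measure.pi fun _ : κ => gaussianReal 0 1) = ENNReal.ofReal √2 ^ Fintype.card κ := by
  simp_rw [Finset.mul_sum, Real.exp_sum,
    ENNReal.ofReal_prod_of_nonneg fun _ _ => (Real.exp_pos _).le]
  rw [lintegral_pi_prod (f := fun k y => ENNReal.ofReal (Real.exp (1 / 4 * y ^ 2)))
    (fun k => by fun_prop)]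
  rw [Finset.prod_const, lintegral_exp_sq_gaussianReal, Finset.card_univ]

theorem sum_sum_sq_of_orthonormal [DecidableEq κ] {u : κ → Fin n → ℝ}
    (hu : ∀ k l, ∑ i, u k i * u l i = if k = l then 1 else 0) (g : κ → ℝ) :
    ∑ i, (∑ k, g k * u k i) ^ 2 = ∑ k, g k ^ 2 := by
  have h : ∀ i, (∑ k, g k * u k i) ^ 2 = ∑ k, ∑ l, g k * g l * (u k i * u l i) := by
    intro i
    rw [sq, Finset.sum_mul_sum]
    exact Finset.sum_congr rfl fun k _ => Finset.sum_congr rfl fun l _ => by ring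
  simp_rw [h]
  rw [Finset.sum_comm]
  refine Finset.sum_congr rfl fun k _ => ?_
  rw [Finset.sum_comm]
  simp_rw [← Finset.mul_sum, hu]
  simp [sq]

variable [IsProbabilityMeasure μ]

/-- Exponential moment of the squared length of an orthogonal projection of a sub-Gaussian
vector. -/
theorem lintegral_exp_sum_sq_le [DecidableEq κ] (hind : iIndepFun (fun i ω => ε ω i) μ)
    (hsub : ∀ i, HasSubgaussianMGF (fun ω => ε ω i) c μ) {u : κ → Fin n → ℝ}
    (hu : ∀ k l, ∑ i, u k i * u l i = if k = l then 1 else 0) {s : ℝ} (hs : 0 ≤ s)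
    (hsc : s * c ≤ 1 / 4) :
    ∫⁻ ω, ENNReal.ofReal (Real.exp (s * ∑ k, (∑ i, u k i * ε ω i) ^ 2)) ∂μ
      ≤ ENNReal.ofReal √2 ^ Fintype.card κ := by
  have hε : AEMeasurable ε μ := aemeasurable_pi_lambda _ fun i => (hsub i).aemeasurable
  -- Linearisation: exp(s a²) is the Gaussian mean of exp(√(2s) a g). After exchanging the integrals
  -- the exponent is linear in ε, so the sub-Gaussian hypothesis applies for fixed g.
  have h1 : ∀ ω, ENNReal.ofReal (Real.exp (s * ∑ k, (∑ i, u k i * ε ω i) ^ 2))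
      = ∫⁻ g, ENNReal.ofReal (Real.exp (∑ k, (√(2 * s) * ∑ i, u k i * ε ω i) * g k))
        ∂(Measure.pi fun _ : κ => gaussianReal 0 1) := by
    intro ω
    rw [lintegral_exp_sum_mul_gaussian]
    congr 2
    rw [Finset.mul_sum]
    refine Finset.sum_congr rfl fun k _ => ?_
    rw [mul_pow, Real.sq_sqrt (by positivity)]
    ring
  simp_rw [h1]
  rw [lintegral_lintegral_swap, ← lintegral_exp_sum_sq_gaussian]
  · refine lintegral_mono fun g => ?_
    have h2 : ∀ ω, ∑ k, (√(2 * s) * ∑ i, u k i * ε ω i) * g k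
        = ∑ i, (√(2 * s) * ∑ k, g k * u k i) * ε ω i := by
      intro ω
      simp_rw [Finset.mul_sum, Finset.sum_mul]
      rw [Finset.sum_comm]
      exact Finset.sum_congr rfl fun i _ => Finset.sum_congr rfl fun k _ => by ring
    simp_rw [h2]
    refine (lintegral_exp_sum_mul_le hind hsub _).trans
      (ENNReal.ofReal_le_ofReal (Real.exp_le_exp.2 ?_))
    simp_rw [mul_pow, Real.sq_sqrt (show 0 ≤ 2 * s by positivity)]
    rw [← Finset.mul_sum, sum_sum_sq_of_orthonormal hu]
    have := Finset.sum_nonneg fun k (_ : k ∈ Finset.univ) => sq_nonneg (g k)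
    nlinarith
  · have hF : Measurable fun p : (Fin n → ℝ) × (κ → ℝ) =>
        ENNReal.ofReal (Real.exp (∑ k, (√(2 * s) * ∑ i, u k i * p.1 i) * p.2 k)) := by fun_prop
    exact hF.comp_aemeasurable (f := fun p : Ω × (κ → ℝ) => (ε p.1, p.2))
      (hε.comp_fst.prodMk measurable_snd.aemeasurable)

/-- Tail bound for the squared length of an orthogonal projection of a sub-Gaussian vector. -/
theorem measure_lt_sum_sq_le [DecidableEq κ] (hind : iIndepFun (fun i ω => ε ω i) μ)
    (hsub : ∀ i, HasSubgaussianMGF (fun ω => ε ω i) c μ) {u : κ → Fin n → ℝ}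
    (hu : ∀ k l, ∑ i, u k i * u l i = if k = l then 1 else 0) (t : ℝ) :
    μ {ω | c * (2 * Fintype.card κ + 4 * t) < ∑ k, (∑ i, u k i * ε ω i) ^ 2}
      ≤ ENNReal.ofReal (Real.exp (-t)) := by
  have hε : AEMeasurable ε μ := aemeasurable_pi_lambda _ fun i => (hsub i).aemeasurable
  -- For c = 0 the noise vanishes almost surely, and the exponent 1 / (4c) used below is not
  -- available.
  rcases eq_or_ne c 0 with rfl | hc
  · have h0 : ∀ᵐ ω ∂μ, ∀ i, ε ω i = 0 :=
      ae_all_iff.2 fun i => (hsub i).ae_eq_zero_of_hasSubgaussianMGF_zero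
    have : μ {ω | ((0 : ℝ≥0) : ℝ) * (2 * Fintype.card κ + 4 * t)
        < ∑ k, (∑ i, u k i * ε ω i) ^ 2} = 0 := by
      rw [← compl_mem_ae_iff]
      filter_upwards [h0] with ω hω
      simp [hω]
    rw [this]; exact bot_le
  · have hc0 : (0 : ℝ) < c := by positivity
    -- This is the largest admissible s. It turns the threshold into m/2 + t, and the m/2 pays for
    -- √2 ^ m because √2 ≤ exp(1/2).
    have h1 := lintegral_exp_sum_sq_le hind hsub hu (s := 1 / (4 * c)) (by positivity)
      (by field_simp; exact le_rfl)
    set m := Fintype.card κ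
    have hF : AEMeasurable (fun ω => ENNReal.ofReal
        (Real.exp (1 / (4 * c) * ∑ k, (∑ i, u k i * ε ω i) ^ 2))) μ := by
      have hF' : Measurable fun x : Fin n → ℝ => ENNReal.ofReal
        (Real.exp (1 / (4 * c) * ∑ k, (∑ i, u k i * x i) ^ 2)) := by fun_prop
      exact hF'.comp_aemeasurable hε
    have hpos : (0 : ℝ) < Real.exp (m / 2 + t) := Real.exp_pos _
    calc μ {ω | c * (2 * m + 4 * t) < ∑ k, (∑ i, u k i * ε ω i) ^ 2}
        ≤ μ {ω | ENNReal.ofReal (Real.exp (m / 2 + t)) ≤ ENNReal.ofReal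
            (Real.exp (1 / (4 * c) * ∑ k, (∑ i, u k i * ε ω i) ^ 2))} := by
          refine measure_mono fun ω hω => ?_
          rw [Set.mem_ofPred_eq] at hω ⊢
          refine ENNReal.ofReal_le_ofReal (Real.exp_le_exp.2 ?_)
          rw [one_div_mul_eq_div, le_div_iff₀ (by positivity)]
          linarith
      _ ≤ ENNReal.ofReal √2 ^ m / ENNReal.ofReal (Real.exp (m / 2 + t)) :=
          (meas_ge_le_lintegral_div hF (by simpa using hpos) ENNReal.ofReal_ne_top).trans
            (ENNReal.div_le_div_right h1 _)
      _ ≤ ENNReal.ofReal (Real.exp (-t)) := by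
          rw [← ENNReal.ofReal_pow (Real.sqrt_nonneg _), ← ENNReal.ofReal_div_of_pos hpos]
          refine ENNReal.ofReal_le_ofReal ?_
          rw [div_le_iff₀ hpos, ← Real.exp_add]
          have h2 : √2 ≤ Real.exp (1 / 2) := by
            have h3 := Real.add_one_le_exp (1 / 2 : ℝ)
            have h4 : √2 ≤ 3 / 2 := by
              rw [Real.sqrt_le_left (by norm_num)]; norm_num
            linarith
          calc √2 ^ m ≤ Real.exp (1 / 2) ^ m := pow_le_pow_left₀ (Real.sqrt_nonneg _) h2 _
            _ = Real.exp (-t + (m / 2 + t)) := by rw [← Real.exp_nat_mul]; congr 1; ring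

/-- The projection is to the coordinates in `V`, with unit vectors as orthonormal family. -/
theorem measure_lt_norm2On_sq_le (hind : iIndepFun (fun i ω => ε ω i) μ)
    (hsub : ∀ i, HasSubgaussianMGF (fun ω => ε ω i) c μ) (V : Finset (Fin n)) (t : ℝ) :
    μ {ω | c * (2 * V.card + 4 * t) < norm2On (ε ω) V ^ 2} ≤ ENNReal.ofReal (Real.exp (-t)) := by
  have h := measure_lt_sum_sq_le hind hsub (κ := V) (u := fun k i => if (k : Fin n) = i then 1 else 0)
    (fun k l => by
      by_cases h : k = l
      · simp [h]
      · simp [h]) t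
  refine le_trans (le_of_eq ?_) h
  congr 1
  ext ω
  rw [Set.mem_ofPred_eq, Set.mem_ofPred_eq, norm2On_sq, ← Finset.sum_coe_sort V]
  simp

/-- Tail bound for the correlation of a sub-Gaussian vector with the column space of `X_S`. -/
theorem measure_exists_lt_sum_mul_le (hind : iIndepFun (fun i ω => ε ω i) μ)
    (hsub : ∀ i, HasSubgaussianMGF (fun ω => ε ω i) c μ) (X : Matrix (Fin n) (Fin d) ℝ)
    (S : Finset (Fin n)) {t : ℝ} (ht : 0 ≤ t) :
    μ {ω | ∃ b : Fin d → ℝ,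
        √(c * (2 * d + 4 * t)) * norm2On (X *ᵥ b) S < ∑ i ∈ S, (X *ᵥ b) i * ε ω i}
      ≤ ENNReal.ofReal (Real.exp (-t)) := by
  classical
  -- The range of `f` is the column space of X_S, extended by zero. Its dimension is at most d, and
  -- by Cauchy-Schwarz the projection of ε to it controls the correlation for all b simultaneously.
  let f : (Fin d → ℝ) →ₗ[ℝ] EuclideanSpace ℝ (Fin n) :=
    { toFun := fun b => WithLp.toLp 2 fun i => if i ∈ S then (X *ᵥ b) i else 0
      map_add' := fun b b' => by
        ext i; by_cases h : i ∈ S <;> simp [h, Matrix.mulVec_add]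
      map_smul' := fun r b => by
        ext i; by_cases h : i ∈ S <;> simp [h, Matrix.mulVec_smul] }
  have hf : ∀ b i, f b i = if i ∈ S then (X *ᵥ b) i else 0 := fun b i => rfl
  let W := LinearMap.range f
  have hdim : Module.finrank ℝ W ≤ d := by
    simpa using LinearMap.finrank_range_le f
  let e := stdOrthonormalBasis ℝ W
  have h := measure_lt_sum_sq_le hind hsub (κ := Fin (Module.finrank ℝ W))
    (u := fun k i => (e k : EuclideanSpace ℝ (Fin n)) i) (fun k l => by
      have h1 := orthonormal_iff_ite.1 e.orthonormal l k
      rw [Submodule.coe_inner, PiLp.inner_apply] at h1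
      simp only [RCLike.inner_apply, conj_trivial] at h1
      rw [h1]
      simp [eq_comm]) t
  refine (measure_mono ?_).trans h
  rintro ω ⟨b, hb⟩
  rw [Set.mem_ofPred_eq]
  by_contra! hcon
  refine absurd hb (not_lt.2 ?_)
  let w : W := ⟨f b, b, rfl⟩
  have hw1 : ‖w‖ = norm2On (X *ᵥ b) S := by
    rw [← sq_eq_sq₀ (norm_nonneg _) (norm2On_nonneg _ _), norm2On_sq, Submodule.coe_norm,
      EuclideanSpace.norm_sq_eq]
    simp [w, hf, Finset.sum_ite_mem, apply_ite, ite_pow]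
  have hw2 : ∀ i, f b i = ∑ k, inner ℝ (e k) w * (e k : EuclideanSpace ℝ (Fin n)) i := by
    intro i
    have h1 := congrArg (fun z : W => (z : EuclideanSpace ℝ (Fin n)) i) (e.sum_repr' w)
    simp only [Submodule.coe_sum, Submodule.coe_smul] at h1
    rw [show f b i = (w : EuclideanSpace ℝ (Fin n)) i from rfl, ← h1]
    simp
  have h3 : ∑ i ∈ S, (X *ᵥ b) i * ε ω i
      = ∑ k, inner ℝ (e k) w * ∑ i, (e k : EuclideanSpace ℝ (Fin n)) i * ε ω i := by
    have h4 : ∑ i ∈ S, (X *ᵥ b) i * ε ω i = ∑ i, f b i * ε ω i := by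
      simp [hf, ite_mul, Finset.sum_ite_mem]
    rw [h4]
    simp_rw [hw2, Finset.sum_mul, Finset.mul_sum]
    rw [Finset.sum_comm]
    exact Finset.sum_congr rfl fun k _ => Finset.sum_congr rfl fun i _ => by ring
  rw [h3]
  refine le_of_sq_le_sq ?_ (mul_nonneg (Real.sqrt_nonneg _) (norm2On_nonneg _ _))
  refine (Finset.sum_mul_sq_le_sq_mul_sq _ _ _).trans ?_
  have h5 : ∑ k, (inner ℝ (e k) w) ^ 2 = ‖w‖ ^ 2 := by
    rw [← e.sum_sq_norm_inner_right w]
    simp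
  rw [h5, hw1, mul_pow, Real.sq_sqrt (by positivity), mul_comm]
  refine mul_le_mul_of_nonneg_right (hcon.trans ?_) (sq_nonneg _)
  have h6 : ((Module.finrank ℝ W : ℕ) : ℝ) ≤ d := by exact_mod_cast hdim
  rw [Fintype.card_fin]
  gcongr

end SubGaussian

/-! ### Independent random designs and union bounds. -/

theorem norm2On_eq_sqrt (v : Fin n → ℝ) (S : Finset (Fin n)) :
    norm2On v S = √(∑ i ∈ S, v i ^ 2) := by
  rw [← norm2On_sq, Real.sqrt_sq (norm2On_nonneg v S)]

section RandomDesign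

variable {Ω : Type*} [MeasurableSpace Ω] {μ : Measure Ω} {ε : Ω → Fin n → ℝ} {c : ℝ≥0}

/-- Tail bound for the correlation of a sub-Gaussian vector with the column space of `X_S`, for an
independent random design. -/
theorem measure_exists_lt_sum_mul_le_of_indepFun [IsProbabilityMeasure μ]
    (hind : iIndepFun (fun i ω => ε ω i) μ)
    (hsub : ∀ i, HasSubgaussianMGF (fun ω => ε ω i) c μ) {X : Ω → Matrix (Fin n) (Fin d) ℝ}
    (hX : AEMeasurable (fun ω i j => X ω i j) μ)
    (hXε : IndepFun (fun ω i j => X ω i j) ε μ) (S : Finset (Fin n)) {t : ℝ} (ht : 0 ≤ t) :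
    μ {ω | ∃ b : Fin d → ℝ,
        √(c * (2 * d + 4 * t)) * norm2On (X ω *ᵥ b) S < ∑ i ∈ S, (X ω *ᵥ b) i * ε ω i}
      ≤ ENNReal.ofReal (Real.exp (-t)) := by
  have hε : AEMeasurable ε μ := aemeasurable_pi_lambda _ fun i => (hsub i).aemeasurable
  set B : Set ((Fin n → Fin d → ℝ) × (Fin n → ℝ)) :=
    {p | ∃ b : Fin d → ℝ, √(c * (2 * d + 4 * t)) * norm2On (Matrix.of p.1 *ᵥ b) S
      < ∑ i ∈ S, (Matrix.of p.1 *ᵥ b) i * p.2 i} with hB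
  -- The union over b is uncountable, but each member is open. Measurability allows conditioning on
  -- the design by Fubini.
  have hBm : MeasurableSet B := by
    refine IsOpen.measurableSet ?_
    rw [hB, Set.ofPred_exists]
    refine isOpen_iUnion fun b => isOpen_lt ?_ ?_
    · simp only [norm2On_eq_sqrt, Matrix.mulVec, dotProduct, Matrix.of_apply]
      fun_prop
    · simp only [Matrix.mulVec, dotProduct, Matrix.of_apply]
      fun_prop
  have h1 : μ {ω | ∃ b : Fin d → ℝ,
      √(c * (2 * d + 4 * t)) * norm2On (X ω *ᵥ b) S < ∑ i ∈ S, (X ω *ᵥ b) i * ε ω i}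
      = (μ.map fun ω => ((fun i j => X ω i j), ε ω)) B := by
    rw [Measure.map_apply_of_aemeasurable (hX.prodMk hε) hBm]
    rfl
  rw [h1, (indepFun_iff_map_prod_eq_prod_map_map hX hε).1 hXε, Measure.prod_apply hBm]
  have := Measure.isProbabilityMeasure_map hX (μ := μ)
  calc ∫⁻ x, (μ.map ε) (Prod.mk x ⁻¹' B) ∂(μ.map fun ω i j => X ω i j)
      ≤ ∫⁻ _, ENNReal.ofReal (Real.exp (-t)) ∂(μ.map fun ω i j => X ω i j) := by
        refine lintegral_mono fun x => ?_
        rw [Measure.map_apply_of_aemeasurable hε (measurable_prodMk_left hBm)]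
        exact measure_exists_lt_sum_mul_le hind hsub (Matrix.of x) S ht
    _ = ENNReal.ofReal (Real.exp (-t)) := by simp

theorem measure_exists_card_eq_le (P : Finset (Fin n) → Set Ω) (k : ℕ) {p : ℝ}
    (h : ∀ S, S.card = k → μ (P S) ≤ ENNReal.ofReal p) :
    μ {ω | ∃ S : Finset (Fin n), S.card = k ∧ ω ∈ P S} ≤ ENNReal.ofReal (n.choose k * p) := by
  calc μ {ω | ∃ S : Finset (Fin n), S.card = k ∧ ω ∈ P S}
      ≤ μ (⋃ S ∈ Finset.powersetCard k (Finset.univ : Finset (Fin n)), P S) := by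
        refine measure_mono ?_
        rintro ω ⟨S, hS, hω⟩
        simp only [Set.mem_iUnion]
        exact ⟨S, by simpa using hS, hω⟩
    _ ≤ ∑ S ∈ Finset.powersetCard k (Finset.univ : Finset (Fin n)), μ (P S) :=
        measure_biUnion_finset_le _ _
    _ ≤ ∑ _S ∈ Finset.powersetCard k (Finset.univ : Finset (Fin n)), ENNReal.ofReal p :=
        Finset.sum_le_sum fun S hS => h S (by simpa using hS)
    _ = ENNReal.ofReal (n.choose k * p) := by
        rw [ENNReal.ofReal_mul (Nat.cast_nonneg _)]
        simp

end RandomDesign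

/-! ### The error bound under the condition on η. -/

/-- The deterministic error bound for Torrent. -/
theorem exists_norm2On_torrent_sub_le (R : SortRule n) (X : Matrix (Fin n) (Fin d) ℝ)
    (β : EuclideanSpace ℝ (Fin d)) (ε o : Fin n → ℝ) {G : Finset (Fin n)} {c : ℕ} (hc : c ≤ n)
    {τ e : ℝ} (hτ : 0 ≤ τ) (hG : G.card ≤ c) (ho : ∀ i ∉ G, o i = 0)
    (hε : ∀ S : Finset (Fin n), S.card = n - c →
      ∀ b : Fin d → ℝ, ∑ i ∈ S, (X *ᵥ b) i * ε i ≤ τ * norm2On (X *ᵥ b) S)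
    (he : ∀ V : Finset (Fin n), V.card ≤ 2 * c → norm2On ε V ≤ e) :
    ∃ S : Finset (Fin n), S.card = n - c ∧ (symDiff G S).card ≤ 2 * c ∧
      norm2On (X *ᵥ (torrent R X (response X β ε o) (n - c) - β).ofLp) S
        ≤ τ + √2 * (e
          + norm2On (X *ᵥ (torrent R X (response X β ε o) (n - c) - β).ofLp) (symDiff G S)) := by
  obtain ⟨S, hS, htor, hmin⟩ := exists_torrent_eq_ols R X (response X β ε o) (Nat.sub_le n c)
  have hV : (symDiff G S).card ≤ 2 * c := card_symDiff_le hG (by omega)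
  refine ⟨S, hS, hV, ?_⟩
  rw [htor]
  refine (norm2On_mulVec_ols_sub_le X β ε o hτ (by omega) ho
    (fun S' hS' => hmin S' (hS'.trans hS)) (hε S hS)).trans ?_
  have := he _ hV
  gcongr

theorem norm2On_mulVec_le_specNorm (X : Matrix (Fin n) (Fin d) ℝ) (V : Finset (Fin n))
    (b : EuclideanSpace ℝ (Fin d)) :
    norm2On (X *ᵥ b.ofLp) V ≤ specNorm (rows X V) * ‖b‖ :=
  Matrix.l2_opNorm_mulVec (rows X V) b

-- Subtracting the smallest eigenvalue shifts the spectrum to the nonnegative half-line, so the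
-- difference is positive semidefinite.
open scoped Pointwise in
theorem lamMin_mul_norm_sq_le (X : Matrix (Fin n) (Fin d) ℝ) (S : Finset (Fin n))
    (b : EuclideanSpace ℝ (Fin d)) :
    lamMin (gram X S) * ‖b‖ ^ 2 ≤ norm2On (X *ᵥ b.ofLp) S ^ 2 := by
  have hA := gram_isHermitian X S
  set l := lamMin (gram X S) with hl
  have hB : (gram X S - l • 1).IsHermitian := hA.sub (by
    simp [Matrix.IsHermitian])
  have hpos : (gram X S - l • 1).PosSemidef := by
    rw [hB.posSemidef_iff_eigenvalues_nonneg]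
    intro i
    have h1 : hB.eigenvalues i ∈ spectrum ℝ (gram X S - l • 1) := hB.eigenvalues_mem_spectrum_real i
    have e : spectrum ℝ (gram X S - l • 1) = spectrum ℝ (gram X S) - ({l} : Set ℝ) := by
      rw [← Algebra.algebraMap_eq_smul_one, spectrum.sub_singleton_eq]
    obtain ⟨x, hx, y, hy, hxy⟩ := Set.mem_sub.1 (e ▸ h1)
    have hy' : y = l := Set.mem_singleton_iff.1 hy
    have h2 : l ≤ x := csInf_le (Matrix.finite_spectrum _).bddBelow hx
    have : (0 : Fin d → ℝ) i = 0 := rfl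
    rw [this]
    linarith
  have h := hpos.dotProduct_mulVec_nonneg b.ofLp
  have e1 : star b.ofLp ⬝ᵥ ((gram X S - l • 1) *ᵥ b.ofLp)
      = norm2On (X *ᵥ b.ofLp) S ^ 2 - l * ‖b‖ ^ 2 := by
    rw [Matrix.sub_mulVec, dotProduct_sub, Matrix.smul_mulVec, Matrix.one_mulVec, dotProduct_smul]
    congr 1
    · rw [norm2On_sq, gram, ← Matrix.mulVec_mulVec, Matrix.dotProduct_mulVec,
        Matrix.vecMul_transpose, ← Finset.sum_coe_sort S]
      simp [dotProduct, rows, Matrix.mulVec, sq]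
    · rw [EuclideanSpace.norm_sq_eq]
      simp [dotProduct, sq]
  rw [e1] at h
  linarith

/-- Besides C(n,k) ≤ n^k / k!, this needs k^k / k! ≤ e^k, one term of the exponential series. -/
theorem choose_le_exp_mul_div_pow (n : ℕ) {k : ℕ} (hk : 1 ≤ k) :
    (n.choose k : ℝ) ≤ (Real.exp 1 * n / k) ^ k := by
  have h1 : (n.choose k : ℝ) ≤ (n : ℝ) ^ k / k.factorial := Nat.choose_le_pow_div k n
  have h2 := Real.pow_div_factorial_le_exp (k : ℝ) (Nat.cast_nonneg k) k
  have hk0 : (0 : ℝ) < k := by exact_mod_cast hk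
  have hf : (0 : ℝ) < k.factorial := by exact_mod_cast k.factorial_pos
  rw [div_le_iff₀ hf] at h2
  refine h1.trans ?_
  rw [div_pow, mul_pow, ← Real.exp_nat_mul, mul_one, div_le_div_iff₀ hf (by positivity)]
  nlinarith [pow_nonneg (Nat.cast_nonneg (α := ℝ) n) k]

/-- The logarithm is made so that the union bound leaves (δ/2)^k. It serves k = c (the sets `S`, by
complements) and k = 2c (the sets `V`), each taking half of δ. -/
theorem choose_mul_exp_neg_le {n c k : ℕ} (hc : 1 ≤ c) (hk : c ≤ k) (hn : 0 < n) {δ : ℝ}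
    (hδ : 0 < δ) (hδ1 : δ ≤ 1) :
    n.choose k * Real.exp (-(k * Real.log (2 * Real.exp 1 * n / (c * δ)))) ≤ δ / 2 := by
  have hc0 : (0 : ℝ) < c := by exact_mod_cast hc
  have hn0 : (0 : ℝ) < n := by exact_mod_cast hn
  have hck : (c : ℝ) ≤ k := by exact_mod_cast hk
  have he := Real.exp_pos 1
  have h1 : Real.exp (-(k * Real.log (2 * Real.exp 1 * n / (c * δ))))
      = ((c * δ) / (2 * Real.exp 1 * n)) ^ k := by
    rw [← mul_neg, ← Real.log_inv, Real.exp_nat_mul, Real.exp_log (by positivity), inv_div]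
  rw [h1]
  calc n.choose k * ((c * δ) / (2 * Real.exp 1 * n)) ^ k
      ≤ (Real.exp 1 * n / c) ^ k * ((c * δ) / (2 * Real.exp 1 * n)) ^ k := by
        gcongr
        refine (choose_le_exp_mul_div_pow n (hc.trans hk)).trans ?_
        gcongr
    _ = (δ / 2) ^ k := by
        rw [← mul_pow]; congr 1; field_simp
    _ ≤ (δ / 2) ^ 1 := pow_le_pow_of_le_one (by positivity) (by linarith) (hc.trans hk)
    _ = δ / 2 := pow_one _

theorem specNorm_nonneg {m : Type*} [Fintype m] [DecidableEq m] (A : Matrix m (Fin d) ℝ) :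
    0 ≤ specNorm A := by
  rw [specNorm, Matrix.l2_opNorm_def]
  exact norm_nonneg _

theorem eta_nonneg (X : Matrix (Fin n) (Fin d) ℝ) (G : Finset (Fin n)) (a : ℕ) :
    0 ≤ eta X G a :=
  Real.iSup_nonneg fun _ => div_nonneg (specNorm_nonneg _) (Real.sqrt_nonneg _)

theorem norm2On_mulVec_symDiff_le {X : Matrix (Fin n) (Fin d) ℝ} {G : Finset (Fin n)} {a : ℕ}
    {S : Finset (Fin n)} (hS : S.card = a) (hl : 0 < lamMin (gram X S))
    (b : EuclideanSpace ℝ (Fin d)) :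
    norm2On (X *ᵥ b.ofLp) (symDiff G S) ≤ eta X G a * norm2On (X *ᵥ b.ofLp) S := by
  have h1 : specNorm (rows X (symDiff G S)) / √(lamMin (gram X S)) ≤ eta X G a :=
    le_ciSup (f := fun S : {S : Finset (Fin n) // S.card = a} =>
      specNorm (rows X (symDiff G S)) / √(lamMin (gram X S))) (Set.finite_range _).bddAbove ⟨S, hS⟩
  have h2 : √(lamMin (gram X S)) * ‖b‖ ≤ norm2On (X *ᵥ b.ofLp) S := by
    refine le_of_sq_le_sq ?_ (norm2On_nonneg _ _)
    rw [mul_pow, Real.sq_sqrt hl.le]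
    exact lamMin_mul_norm_sq_le X S b
  rw [div_le_iff₀ (Real.sqrt_pos.2 hl)] at h1
  calc norm2On (X *ᵥ b.ofLp) (symDiff G S) ≤ specNorm (rows X (symDiff G S)) * ‖b‖ :=
        norm2On_mulVec_le_specNorm X _ b
    _ ≤ eta X G a * √(lamMin (gram X S)) * ‖b‖ := by gcongr
    _ ≤ eta X G a * norm2On (X *ᵥ b.ofLp) S := by
        rw [mul_assoc]; exact mul_le_mul_of_nonneg_left h2 (eta_nonneg X G a)

theorem lam_mul_norm_le {X : Matrix (Fin n) (Fin d) ℝ} {a : ℕ} {S : Finset (Fin n)}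
    (hS : S.card = a) (hl : 0 < lamMin (gram X S)) (b : EuclideanSpace ℝ (Fin d)) :
    lam X a * ‖b‖ ≤ norm2On (X *ᵥ b.ofLp) S := by
  have h1 : lam X a ≤ √(lamMin (gram X S)) :=
    ciInf_le (f := fun S : {S : Finset (Fin n) // S.card = a} => √(lamMin (gram X S)))
      (Set.finite_range _).bddBelow ⟨S, hS⟩
  refine (mul_le_mul_of_nonneg_right h1 (norm_nonneg b)).trans
    (le_of_sq_le_sq ?_ (norm2On_nonneg _ _))
  rw [mul_pow, Real.sq_sqrt hl.le]
  exact lamMin_mul_norm_sq_le X S b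

theorem lam_pos {X : Matrix (Fin n) (Fin d) ℝ} {a : ℕ} (ha : a ≤ n)
    (h : ∀ S : Finset (Fin n), S.card = a → 0 < lamMin (gram X S)) : 0 < lam X a := by
  obtain ⟨S₀, -, hS₀⟩ := Finset.exists_subset_card_eq (s := (Finset.univ : Finset (Fin n)))
    (n := a) (by simpa using ha)
  have : Nonempty {S : Finset (Fin n) // S.card = a} := ⟨⟨S₀, hS₀⟩⟩
  obtain ⟨S, hS⟩ := exists_eq_ciInf_of_finite
    (f := fun S : {S : Finset (Fin n) // S.card = a} => √(lamMin (gram X S)))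
  rw [lam, ← hS]
  exact Real.sqrt_pos.2 (h S S.2)

theorem sqrt_add_le_sqrt_add_sqrt {x y : ℝ} (hx : 0 ≤ x) (hy : 0 ≤ y) : √(x + y) ≤ √x + √y := by
  rw [Real.sqrt_le_left (by positivity), add_sq, Real.sq_sqrt hx, Real.sq_sqrt hy]
  have : 0 ≤ 2 * √x * √y := by positivity
  linarith

/-- The threshold obtained from the tail bounds lies below `errorBound` with constant `9`. -/
theorem div_le_errorBound {σ η l δ L : ℝ} {n d c : ℕ} (hσ : 0 ≤ σ) (hl : 0 < l)
    (hη : 0 < 1 - √2 * η) (hL : L = Real.log (2 * Real.exp 1 * n / (c * δ))) (hL1 : 1 ≤ L) :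
    (√(σ ^ 2 * (2 * d + 4 * (c * L))) + √2 * √(σ ^ 2 * (2 * (2 * c) + 4 * (2 * c * L))))
      / (l * (1 - √2 * η)) ≤ errorBound 9 σ η l δ n d c := by
  have hL0 : 0 ≤ L := by linarith
  rw [errorBound, ← hL, add_div]
  refine add_le_add ?_ ?_
  · have h1 : √(σ ^ 2 * (2 * d + 4 * (c * L))) ≤ σ * (√2 * (√d + √(2 * c * 9 * L))) := by
      rw [Real.sqrt_mul (sq_nonneg σ), Real.sqrt_sq hσ]
      gcongr
      rw [show 2 * (d : ℝ) + 4 * (c * L) = 2 * (d + 2 * c * L) by ring, Real.sqrt_mul zero_le_two]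
      gcongr
      refine (sqrt_add_le_sqrt_add_sqrt (by positivity) (by positivity)).trans
        (add_le_add_right (Real.sqrt_le_sqrt ?_) _)
      nlinarith [mul_nonneg (Nat.cast_nonneg (α := ℝ) c) hL0]
    calc √(σ ^ 2 * (2 * d + 4 * (c * L))) / (l * (1 - √2 * η))
        ≤ σ * (√2 * (√d + √(2 * c * 9 * L))) / (l * (1 - √2 * η)) := by gcongr
      _ = σ / l * (0 + √2 / (1 - √2 * η)) * (√d + √(2 * c * 9 * L)) := by field_simp; ring
      _ ≤ σ / l * (1 + √2 / (1 - √2 * η)) * (√d + √(2 * c * 9 * L)) := by gcongr; norm_num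
  · refine div_le_div_of_nonneg_right ?_ (by positivity)
    rw [← Real.sqrt_mul zero_le_two, Real.sqrt_le_left (by positivity)]
    -- The constant 9 is not optimised; as a square it keeps the comparison polynomial in √L.
    have h9 : √(9 * L) = 3 * √L := by
      rw [Real.sqrt_mul (by norm_num), show (9 : ℝ) = 3 ^ 2 by norm_num, Real.sqrt_sq (by norm_num)]
    have hs : √L ^ 2 = L := Real.sq_sqrt hL0
    have hs1 : 1 ≤ √L := Real.one_le_sqrt.2 hL1
    have hcs : √(c : ℝ) ^ 2 = c := Real.sq_sqrt (Nat.cast_nonneg c)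
    rw [h9, mul_pow, mul_pow, mul_pow, hcs]
    have h2 : 8 + 16 * L ≤ 4 * (1 + 3 * √L) ^ 2 := by nlinarith
    have h3 : 0 ≤ σ ^ 2 * c := by positivity
    nlinarith [mul_le_mul_of_nonneg_left h2 h3]

/-- The error bound for Torrent. -/
theorem exists_measurableSet_norm_torrent_sub_le {n d c : ℕ} (hc : 1 ≤ c) (hcn : 2 * c < n)
    (R : SortRule n) {Ω : Type*} [MeasurableSpace Ω] {μ : Measure Ω} [IsProbabilityMeasure μ]
    (β : EuclideanSpace ℝ (Fin d)) {X : Ω → Matrix (Fin n) (Fin d) ℝ}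
    {ε o : Ω → Fin n → ℝ} {G : Ω → Finset (Fin n)} {σ : ℝ≥0}
    (hX : AEMeasurable (fun ω i j => X ω i j) μ) (hε : IsSubGaussianNoise ε σ μ)
    (hXε : IndepFun (fun ω i j => X ω i j) ε μ) (hG : ∀ ω, (G ω).card ≤ c)
    (ho : ∀ ω, ∀ i ∉ G ω, o ω i = 0)
    (hη : ∀ᵐ ω ∂μ, EtaCondition (X ω) (G ω) (n - c)) {δ : ℝ} (hδ : 0 < δ) :
    ∃ E : Set Ω, MeasurableSet E ∧ 1 - δ ≤ μ.real E ∧ ∀ ω ∈ E,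
      ‖torrent R (X ω) (response (X ω) β (ε ω) (o ω)) (n - c) - β‖
        ≤ errorBound 9 σ (eta (X ω) (G ω) (n - c)) (lam (X ω) (n - c)) δ n d c := by
  rcases le_or_gt δ 1 with hδ1 | hδ1
  swap
  -- For δ > 1 the probability requirement is void.
  · exact ⟨∅, MeasurableSet.empty, by simp; linarith, by simp⟩
  set L := Real.log (2 * Real.exp 1 * n / (c * δ)) with hL
  have hc0 : (0 : ℝ) < c := by exact_mod_cast hc
  have hL1 : 1 ≤ L := by
    have hn0 : (0 : ℝ) < n := by exact_mod_cast (by omega : 0 < n)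
    rw [hL, Real.le_log_iff_exp_le (by positivity), le_div_iff₀ (by positivity)]
    have h1 : (c : ℝ) ≤ n := by exact_mod_cast (by omega : c ≤ n)
    have h2 : (c : ℝ) * δ ≤ n := by nlinarith
    nlinarith [Real.exp_pos 1]
  have hL0 : 0 ≤ L := by linarith
  set P₁ : Finset (Fin n) → Set Ω := fun S => {ω | ∃ b : Fin d → ℝ,
    √((σ ^ 2 : ℝ≥0) * (2 * d + 4 * (c * L))) * norm2On (X ω *ᵥ b) S
      < ∑ i ∈ S, (X ω *ᵥ b) i * ε ω i} with hP₁
  set P₂ : Finset (Fin n) → Set Ω := fun V => {ω |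
    (σ ^ 2 : ℝ≥0) * (2 * V.card + 4 * ((2 * c : ℕ) * L)) < norm2On (ε ω) V ^ 2} with hP₂
  have h₁ : μ {ω | ∃ S : Finset (Fin n), S.card = n - c ∧ ω ∈ P₁ S} ≤ ENNReal.ofReal (δ / 2) := by
    refine (measure_exists_card_eq_le P₁ (n - c) fun S _ =>
      measure_exists_lt_sum_mul_le_of_indepFun hε.indep hε.subGaussian hX hXε S
        (by positivity)).trans (ENNReal.ofReal_le_ofReal ?_)
    rw [Nat.choose_symm (by omega)]
    exact choose_mul_exp_neg_le hc le_rfl (by omega) hδ hδ1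
  have h₂ : μ {ω | ∃ S : Finset (Fin n), S.card = 2 * c ∧ ω ∈ P₂ S} ≤ ENNReal.ofReal (δ / 2) := by
    refine (measure_exists_card_eq_le P₂ (2 * c) fun V _ =>
      measure_lt_norm2On_sq_le hε.indep hε.subGaussian V _).trans (ENNReal.ofReal_le_ofReal ?_)
    exact choose_mul_exp_neg_le hc (by omega) (by omega) hδ hδ1
  set B : Set Ω := {ω | ¬ ‖torrent R (X ω) (response (X ω) β (ε ω) (o ω)) (n - c) - β‖
    ≤ errorBound 9 σ (eta (X ω) (G ω) (n - c)) (lam (X ω) (n - c)) δ n d c} with hBdef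
  have hB : μ B ≤ ENNReal.ofReal δ := by
    have hsub : B ≤ᵐ[μ] ({ω | ∃ S : Finset (Fin n), S.card = n - c ∧ ω ∈ P₁ S}
        ∪ {ω | ∃ S : Finset (Fin n), S.card = 2 * c ∧ ω ∈ P₂ S} : Set Ω) := by
      filter_upwards [hη] with ω hω hωB
      by_contra hcon
      refine hωB ?_
      replace hcon : ω ∉ ({ω | ∃ S : Finset (Fin n), S.card = n - c ∧ ω ∈ P₁ S}
        ∪ {ω | ∃ S : Finset (Fin n), S.card = 2 * c ∧ ω ∈ P₂ S} : Set Ω) := hcon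
      simp only [Set.mem_union, Set.mem_ofPred_eq, not_or, not_exists, not_and, hP₁, hP₂,
        not_lt] at hcon
      obtain ⟨hc1, hc2⟩ := hcon
      obtain ⟨hlam, heta⟩ := hω
      set b := torrent R (X ω) (response (X ω) β (ε ω) (o ω)) (n - c) - β with hb
      set η := eta (X ω) (G ω) (n - c)
      set e := √((σ : ℝ) ^ 2 * (2 * (2 * c) + 4 * (2 * c * L))) with he
      -- Smaller sets are enlarged to size exactly 2c, which is possible since 2c < n, so the union
      -- runs over one size only.
      have hcard : ∀ V : Finset (Fin n), V.card ≤ 2 * c → norm2On (ε ω) V ≤ e := by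
        intro V hV
        obtain ⟨V', hVV', -, hV'⟩ := Finset.exists_subsuperset_card_eq (Finset.subset_univ V) hV
          (by simpa using hcn.le)
        refine (norm2On_mono _ hVV').trans (Real.le_sqrt_of_sq_le ?_)
        have := hc2 V' hV'
        rw [hV'] at this
        push_cast at this
        exact this
      obtain ⟨S, hS, -, hq⟩ := exists_norm2On_torrent_sub_le R (X ω) β (ε ω) (o ω)
        (by omega : c ≤ n) (Real.sqrt_nonneg _) (hG ω) (ho ω) hc1 hcard
      rw [← hb] at hq
      have h2 := norm2On_mulVec_symDiff_le (G := G ω) hS (hlam S hS) b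
      have h3 := lam_mul_norm_le hS (hlam S hS) b
      have hlp := lam_pos (Nat.sub_le n c) hlam
      have hs2 : 0 < √(2 : ℝ) := by positivity
      have hη1 : 0 < 1 - √2 * η := by
        rw [lt_div_iff₀ hs2] at heta; linarith
      refine le_trans ?_ (div_le_errorBound σ.2 hlp hη1 hL hL1)
      rw [le_div_iff₀ (by positivity)]
      have hq' : norm2On (X ω *ᵥ b.ofLp) S * (1 - √2 * η)
          ≤ √((σ : ℝ) ^ 2 * (2 * d + 4 * (c * L))) + √2 * e := by
        have := mul_le_mul_of_nonneg_left h2 hs2.le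
        push_cast at hq
        linarith
      calc ‖b‖ * (lam (X ω) (n - c) * (1 - √2 * η))
          = lam (X ω) (n - c) * ‖b‖ * (1 - √2 * η) := by ring
        _ ≤ norm2On (X ω *ᵥ b.ofLp) S * (1 - √2 * η) := by gcongr
        _ ≤ _ := hq'
    calc μ B ≤ _ := measure_mono_ae hsub
      _ ≤ _ := measure_union_le _ _
      _ ≤ ENNReal.ofReal (δ / 2) + ENNReal.ofReal (δ / 2) := add_le_add h₁ h₂
      _ = ENNReal.ofReal δ := by
        rw [← ENNReal.ofReal_add (by positivity) (by positivity), add_halves]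
  -- The adversary may be non-measurable, hence so may `B`; the event is the complement of a
  -- measurable hull of the same outer measure.
  refine ⟨(toMeasurable μ B)ᶜ, (measurableSet_toMeasurable μ B).compl, ?_, fun ω hω => ?_⟩
  · rw [probReal_compl_eq_one_sub (measurableSet_toMeasurable μ B), measureReal_def,
      measure_toMeasurable]
    have := ENNReal.toReal_le_of_le_ofReal hδ.le hB
    linarith
  · by_contra hcon
    exact hω (subset_toMeasurable μ B hcon)

/-! ### Moments of Gaussian rows and concentration of XᵀX. -/

theorem hasLaw_apply_stdGaussian (j : Fin d) :
    HasLaw (fun x : EuclideanSpace ℝ (Fin d) => x j) (gaussianReal 0 1)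
      (stdGaussian (EuclideanSpace ℝ (Fin d))) := by
  refine ⟨by fun_prop, ?_⟩
  rw [← map_pi_eq_stdGaussian, Measure.map_map (by fun_prop) (by fun_prop)]
  exact (measurePreserving_eval (fun _ : Fin d => gaussianReal 0 1) j).map_eq

theorem hasSubgaussianMGF_of_hasLaw {Ω : Type*} [MeasurableSpace Ω] {μ : Measure Ω} {Y : Ω → ℝ}
    (hY : HasLaw Y (gaussianReal 0 1) μ) : HasSubgaussianMGF Y 1 μ := by
  have hid : HasSubgaussianMGF id 1 (μ.map Y) := by
    rw [hY.map_eq]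
    refine ⟨fun t => integrable_exp_mul_gaussianReal t, fun t => ?_⟩
    rw [mgf_id_gaussianReal]
    simp
  exact HasSubgaussianMGF.of_map (X := id) hY.aemeasurable hid

theorem memLp_mul_stdGaussian (j k : Fin d) :
    MemLp (fun x : EuclideanSpace ℝ (Fin d) => x j * x k) 2
      (stdGaussian (EuclideanSpace ℝ (Fin d))) := by
  have h : ∀ j : Fin d, MemLp (fun x : EuclideanSpace ℝ (Fin d) => x j) 4
      (stdGaussian (EuclideanSpace ℝ (Fin d))) := fun j => by
    simpa using (hasSubgaussianMGF_of_hasLaw (hasLaw_apply_stdGaussian j)).memLp 4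
  have : ENNReal.HolderTriple 4 4 2 := ⟨by
    rw [show (4 : ENNReal) = 2 * 2 by norm_num, ENNReal.mul_inv (by simp) (by simp), ← mul_add,
      ENNReal.inv_two_add_inv_two, mul_one]⟩
  exact (h k).mul (h j)

theorem integral_mul_stdGaussian (j k : Fin d) :
    ∫ x, x j * x k ∂(stdGaussian (EuclideanSpace ℝ (Fin d))) = if j = k then 1 else 0 := by
  have h := covarianceBilin_apply (μ := stdGaussian (EuclideanSpace ℝ (Fin d)))
    IsGaussian.memLp_two_id (EuclideanSpace.single j 1) (EuclideanSpace.single k 1)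
  simp only [id, integral_id_stdGaussian, covarianceBilin_stdGaussian, sub_zero] at h
  simp only [EuclideanSpace.inner_single_left, map_one, one_mul] at h
  rw [← h]
  change inner ℝ (EuclideanSpace.single j (1 : ℝ)) (EuclideanSpace.single k (1 : ℝ)) = _
  rw [EuclideanSpace.inner_single_left]
  simp

section GaussianDesign

variable {Ω : Type*} [MeasurableSpace Ω] {μ : Measure Ω} {X : Ω → Matrix (Fin n) (Fin d) ℝ}

/-- Chebyshev's inequality for the entries of `Xᵀ X`. -/
theorem measure_le_abs_sum_mul_sub_le [IsProbabilityMeasure μ]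
    (hind : iIndepFun (fun i ω => (WithLp.toLp 2 (X ω i) : EuclideanSpace ℝ (Fin d))) μ)
    (hlaw : ∀ i, HasLaw (fun ω => (WithLp.toLp 2 (X ω i) : EuclideanSpace ℝ (Fin d)))
      (stdGaussian (EuclideanSpace ℝ (Fin d))) μ) (hn : 0 < n) (j k : Fin d) {r : ℝ} (hr : 0 < r) :
    μ {ω | r * n ≤ |∑ i, X ω i j * X ω i k - n * if j = k then 1 else 0|}
      ≤ ENNReal.ofReal (Var[fun x : EuclideanSpace ℝ (Fin d) => x j * x k;
          stdGaussian (EuclideanSpace ℝ (Fin d))] / r ^ 2 / n) := by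
  have hn0 : (0 : ℝ) < n := by exact_mod_cast hn
  set f : EuclideanSpace ℝ (Fin d) → ℝ := fun x => x j * x k with hf
  have hfm : Measurable f := by fun_prop
  set Z : Fin n → Ω → ℝ := fun i ω => X ω i j * X ω i k with hZ
  have hZf : ∀ i, Z i = f ∘ fun ω => (WithLp.toLp 2 (X ω i) : EuclideanSpace ℝ (Fin d)) :=
    fun i => rfl
  have hmem : ∀ i, MemLp (Z i) 2 μ := by
    intro i
    rw [hZf]
    refine (memLp_map_measure_iff hfm.aestronglyMeasurable (hlaw i).aemeasurable).1 ?_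
    rw [(hlaw i).map_eq]
    exact memLp_mul_stdGaussian j k
  have hvar : ∀ i, Var[Z i; μ] = Var[f; stdGaussian (EuclideanSpace ℝ (Fin d))] := by
    intro i
    rw [hZf, ← (hlaw i).map_eq, variance_map hfm.aemeasurable (hlaw i).aemeasurable]
  have hmean : ∀ i, ∫ ω, Z i ω ∂μ = if j = k then 1 else 0 := by
    intro i
    rw [← integral_mul_stdGaussian j k]
    exact (hlaw i).integral_comp hfm.aestronglyMeasurable
  have hindZ : iIndepFun Z μ := hind.comp (fun _ => f) fun _ => hfm
  have hsum : MemLp (∑ i, Z i) 2 μ := memLp_finsetSum' _ fun i _ => hmem i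
  have h := meas_ge_le_variance_div_sq hsum (c := r * n) (by positivity)
  have hv : Var[∑ i, Z i; μ] = n * Var[f; stdGaussian (EuclideanSpace ℝ (Fin d))] := by
    rw [IndepFun.variance_sum (fun i _ => hmem i) fun i _ i' _ hii' => hindZ.indepFun hii']
    simp [hvar]
  have hm : ∫ ω, (∑ i, Z i) ω ∂μ = n * if j = k then 1 else 0 := by
    simp only [Finset.sum_apply]
    rw [integral_finsetSum _ fun i _ => (hmem i).integrable (by norm_num)]
    simp [hmean]
  rw [hv, hm] at h
  simp only [Finset.sum_apply, hZ] at h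
  refine h.trans (ENNReal.ofReal_le_ofReal (le_of_eq ?_))
  field_simp

theorem iIndepFun_column
    (hind : iIndepFun (fun i ω => (WithLp.toLp 2 (X ω i) : EuclideanSpace ℝ (Fin d))) μ)
    (j : Fin d) : iIndepFun (fun i ω => X ω i j) μ :=
  hind.comp (fun _ (x : EuclideanSpace ℝ (Fin d)) => x j) fun _ => by fun_prop

theorem hasSubgaussianMGF_entry
    (hlaw : ∀ i, HasLaw (fun ω => (WithLp.toLp 2 (X ω i) : EuclideanSpace ℝ (Fin d)))
      (stdGaussian (EuclideanSpace ℝ (Fin d))) μ) (i : Fin n) (j : Fin d) :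
    HasSubgaussianMGF (fun ω => X ω i j) 1 μ :=
  hasSubgaussianMGF_of_hasLaw ((hasLaw_apply_stdGaussian j).comp (hlaw i))

end GaussianDesign

/-! ### Well-conditioned designs and the Gaussian tail bound. -/

/-- This bounds the spectral norm by the Frobenius norm, column by column. The lost factor d is
harmless for fixed d, and one-dimensional tail bounds for the columns suffice. -/
theorem norm2On_mulVec_sq_le (X : Matrix (Fin n) (Fin d) ℝ) (V : Finset (Fin n))
    (b : EuclideanSpace ℝ (Fin d)) {κ : ℝ} (h : ∀ j, norm2On (fun i => X i j) V ^ 2 ≤ κ) :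
    norm2On (X *ᵥ b.ofLp) V ^ 2 ≤ d * κ * ‖b‖ ^ 2 := by
  calc norm2On (X *ᵥ b.ofLp) V ^ 2 = ∑ i ∈ V, (∑ j, X i j * b j) ^ 2 := by
        rw [norm2On_sq]; rfl
    _ ≤ ∑ i ∈ V, (∑ j, X i j ^ 2) * ∑ j, b j ^ 2 :=
        Finset.sum_le_sum fun i _ => Finset.sum_mul_sq_le_sq_mul_sq _ _ _
    _ = (∑ j, norm2On (fun i => X i j) V ^ 2) * ‖b‖ ^ 2 := by
        rw [← Finset.sum_mul, Finset.sum_comm, EuclideanSpace.real_norm_sq_eq]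
        simp_rw [norm2On_sq]
    _ ≤ d * κ * ‖b‖ ^ 2 := by
        gcongr
        calc ∑ j, norm2On (fun i => X i j) V ^ 2 ≤ ∑ _j : Fin d, κ :=
              Finset.sum_le_sum fun j _ => h j
          _ = d * κ := by simp

/-- Entrywise closeness changes the quadratic form by at most (∑ |b_j|)² ≤ d ‖b‖² times the
tolerance; d + 1 in the denominator covers d = 0. -/
theorem half_mul_norm_sq_le (X : Matrix (Fin n) (Fin d) ℝ) (b : EuclideanSpace ℝ (Fin d))
    (h : ∀ j k, |∑ i, X i j * X i k - n * if j = k then 1 else 0| ≤ 1 / (2 * (d + 1)) * n) :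
    (n : ℝ) / 2 * ‖b‖ ^ 2 ≤ norm2On (X *ᵥ b.ofLp) Finset.univ ^ 2 := by
  have h1 : norm2On (X *ᵥ b.ofLp) Finset.univ ^ 2
      = ∑ j, ∑ k, b j * b k * ∑ i, X i j * X i k := by
    calc norm2On (X *ᵥ b.ofLp) Finset.univ ^ 2 = ∑ i, ∑ j, ∑ k, b j * b k * (X i j * X i k) := by
          rw [norm2On_sq]
          refine Finset.sum_congr rfl fun i _ => ?_
          change (∑ j, X i j * b j) ^ 2 = _
          rw [sq, Finset.sum_mul_sum]
          exact Finset.sum_congr rfl fun j _ => Finset.sum_congr rfl fun k _ => by ring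
      _ = _ := by
          rw [Finset.sum_comm]
          refine Finset.sum_congr rfl fun j _ => ?_
          rw [Finset.sum_comm]
          simp_rw [Finset.mul_sum]
  have h2 : (n : ℝ) * ‖b‖ ^ 2 = ∑ j, ∑ k, b j * b k * (n * if j = k then 1 else 0) := by
    rw [EuclideanSpace.real_norm_sq_eq, Finset.mul_sum]
    refine Finset.sum_congr rfl fun j _ => ?_
    simp
    ring
  have h3 : n * ‖b‖ ^ 2 - norm2On (X *ᵥ b.ofLp) Finset.univ ^ 2
      ≤ ∑ j, ∑ k, |b j| * |b k| * (1 / (2 * (d + 1)) * n) := by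
    rw [h1, h2, ← Finset.sum_sub_distrib]
    refine Finset.sum_le_sum fun j _ => ?_
    rw [← Finset.sum_sub_distrib]
    refine Finset.sum_le_sum fun k _ => ?_
    rw [← mul_sub]
    refine (le_abs_self _).trans ?_
    rw [abs_mul, abs_mul, abs_sub_comm]
    exact mul_le_mul_of_nonneg_left (h j k) (by positivity)
  have h4 : ∑ j, ∑ k, |b j| * |b k| * (1 / (2 * (d + 1)) * n)
      = (∑ j, |b j|) ^ 2 * (1 / (2 * (d + 1)) * n) := by
    rw [sq, Finset.sum_mul_sum]
    simp_rw [Finset.sum_mul]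
  have h5 : (∑ j, |b j|) ^ 2 ≤ d * ‖b‖ ^ 2 := by
    have := sq_sum_le_card_mul_sum_sq (s := Finset.univ) (f := fun j => |b j|)
    simpa [EuclideanSpace.real_norm_sq_eq] using this
  have h6 : (d : ℝ) * ‖b‖ ^ 2 * (1 / (2 * (d + 1)) * n) ≤ n / 2 * ‖b‖ ^ 2 := by
    have e : (d : ℝ) * ‖b‖ ^ 2 * (1 / (2 * (d + 1)) * n)
        = d / (d + 1) * (n / 2 * ‖b‖ ^ 2) := by field_simp
    rw [e]
    refine mul_le_of_le_one_left (by positivity) ?_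
    rw [div_le_one (by positivity)]
    linarith
  have h7 := mul_le_mul_of_nonneg_right h5 (show (0 : ℝ) ≤ 1 / (2 * (d + 1)) * n by positivity)
  linarith

/-- The deterministic error bound for a well-conditioned design. -/
theorem norm_torrent_sub_le (R : SortRule n) (X : Matrix (Fin n) (Fin d) ℝ)
    (β : EuclideanSpace ℝ (Fin d)) (ε o : Fin n → ℝ) {G : Finset (Fin n)} {c : ℕ} (hc : c ≤ n)
    (hn : 0 < n) {τ e κ : ℝ} (hτ : 0 ≤ τ) (hG : G.card ≤ c) (ho : ∀ i ∉ G, o i = 0)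
    (hε : ∀ S : Finset (Fin n), S.card = n - c →
      ∀ b : Fin d → ℝ, ∑ i ∈ S, (X *ᵥ b) i * ε i ≤ τ * norm2On (X *ᵥ b) S)
    (he : ∀ V : Finset (Fin n), V.card ≤ 2 * c → norm2On ε V ≤ e)
    (hV : ∀ V : Finset (Fin n), V.card ≤ 2 * c → ∀ j, norm2On (fun i => X i j) V ^ 2 ≤ κ)
    (hκ : d * κ ≤ n / 32)
    (hX : ∀ j k, |∑ i, X i j * X i k - n * if j = k then 1 else 0| ≤ 1 / (2 * (d + 1)) * n) :
    ‖torrent R X (response X β ε o) (n - c) - β‖ ≤ 4 * (τ + √2 * e) / √n := by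
  have hn0 : (0 : ℝ) < n := by exact_mod_cast hn
  obtain ⟨S, hS, hVc, hq⟩ := exists_norm2On_torrent_sub_le R X β ε o hc hτ hG ho hε he
  set b := torrent R X (response X β ε o) (n - c) - β
  have hbV : ∀ V : Finset (Fin n), V.card ≤ 2 * c →
      norm2On (X *ᵥ b.ofLp) V ^ 2 ≤ n / 32 * ‖b‖ ^ 2 := fun V hV' =>
    (norm2On_mulVec_sq_le X V b (hV V hV')).trans (by gcongr)
  have hSc : Sᶜ.card ≤ 2 * c := by rw [Finset.card_compl, Fintype.card_fin]; omega
  have h1 : norm2On (X *ᵥ b.ofLp) S ^ 2 + norm2On (X *ᵥ b.ofLp) Sᶜ ^ 2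
      = norm2On (X *ᵥ b.ofLp) Finset.univ ^ 2 := by
    simp only [norm2On_sq]; exact Finset.sum_add_sum_compl S _
  have h2 := half_mul_norm_sq_le X b hX
  have h3 := hbV _ hSc
  have hb2 : 0 ≤ n * ‖b‖ ^ 2 := by positivity
  have hs : √(n : ℝ) ^ 2 = n := Real.sq_sqrt hn0.le
  have hs0 : 0 < √(n : ℝ) := Real.sqrt_pos.2 hn0
  -- The complement of S has at most c rows, so ‖w_S‖² ≥ (n/2 - n/32) ‖b‖² ≥ (n/4) ‖b‖².
  have h4 : √n * ‖b‖ ≤ 2 * norm2On (X *ᵥ b.ofLp) S := by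
    refine le_of_sq_le_sq ?_ (mul_nonneg zero_le_two (norm2On_nonneg _ _))
    rw [mul_pow, mul_pow, hs]
    linarith
  -- The fraction 1/32 is chosen for this: √2 ‖w_V‖ uses up half of the lower bound √n ‖b‖ / 2, and
  -- the other half gives the factor 4.
  have h5 : √2 * norm2On (X *ᵥ b.ofLp) (symDiff G S) ≤ √n * ‖b‖ / 4 := by
    refine le_of_sq_le_sq ?_ (by positivity)
    have := hbV _ hVc
    rw [mul_pow, div_pow, mul_pow, hs, Real.sq_sqrt zero_le_two]
    linarith
  rw [le_div_iff₀ hs0]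
  linarith

theorem norm2On_sq_le_of_card_eq {c : ℕ} (hcn : 2 * c ≤ n) {v : Fin n → ℝ} {B : ℝ}
    (h : ∀ V : Finset (Fin n), V.card = 2 * c → norm2On v V ^ 2 ≤ B) (V : Finset (Fin n))
    (hV : V.card ≤ 2 * c) : norm2On v V ^ 2 ≤ B := by
  obtain ⟨V', hVV', -, hV'⟩ := Finset.exists_subsuperset_card_eq (Finset.subset_univ V) hV
    (by simpa using hcn)
  exact (pow_le_pow_left₀ (norm2On_nonneg _ _) (norm2On_mono _ hVV') 2).trans (h V' hV')

/-- A tail bound for the error of Torrent with a standard Gaussian design. -/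
theorem measure_lt_norm_torrent_sub_le {Ω : Type*} [MeasurableSpace Ω] {μ : Measure Ω}
    [IsProbabilityMeasure μ] {X : Ω → Matrix (Fin n) (Fin d) ℝ} {ε o : Ω → Fin n → ℝ}
    {G : Ω → Finset (Fin n)} {σ : ℝ≥0} {c : ℕ} (hcn : 2 * c ≤ n) (hn : 0 < n) (R : SortRule n)
    (β : EuclideanSpace ℝ (Fin d))
    (hind : iIndepFun (fun i ω => (WithLp.toLp 2 (X ω i) : EuclideanSpace ℝ (Fin d))) μ)
    (hlaw : ∀ i, HasLaw (fun ω => (WithLp.toLp 2 (X ω i) : EuclideanSpace ℝ (Fin d)))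
      (stdGaussian (EuclideanSpace ℝ (Fin d))) μ)
    (hε : IsSubGaussianNoise ε σ μ) (hXε : IndepFun (fun ω i j => X ω i j) ε μ)
    (hG : ∀ ω, (G ω).card ≤ c) (ho : ∀ ω, ∀ i ∉ G ω, o ω i = 0) {t : ℝ} (ht : 0 ≤ t)
    (hκ : d * (2 * (2 * c) + 4 * t) ≤ n / 32) :
    μ {ω | 4 * (√(σ ^ 2 * (2 * d + 4 * t)) + √2 * √(σ ^ 2 * (2 * (2 * c) + 4 * t))) / √n
        < ‖torrent R (X ω) (response (X ω) β (ε ω) (o ω)) (n - c) - β‖}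
      ≤ ENNReal.ofReal (n.choose c * Real.exp (-t))
        + ENNReal.ofReal (n.choose (2 * c) * Real.exp (-t))
        + ∑ _j : Fin d, ENNReal.ofReal (n.choose (2 * c) * Real.exp (-t))
        + ∑ j : Fin d, ∑ k : Fin d,
          ENNReal.ofReal (Var[fun x : EuclideanSpace ℝ (Fin d) => x j * x k;
            stdGaussian (EuclideanSpace ℝ (Fin d))] / (1 / (2 * (d + 1))) ^ 2 / n) := by
  have hX : AEMeasurable (fun ω i j => X ω i j) μ :=
    aemeasurable_pi_lambda _ fun i => aemeasurable_pi_lambda _ fun j =>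
      (hasSubgaussianMGF_entry hlaw i j).aemeasurable
  set P₁ : Finset (Fin n) → Set Ω := fun S => {ω | ∃ b : Fin d → ℝ,
    √((σ ^ 2 : ℝ≥0) * (2 * d + 4 * t)) * norm2On (X ω *ᵥ b) S
      < ∑ i ∈ S, (X ω *ᵥ b) i * ε ω i} with hP₁
  set P₂ : Finset (Fin n) → Set Ω := fun V => {ω |
    (σ ^ 2 : ℝ≥0) * (2 * V.card + 4 * t) < norm2On (ε ω) V ^ 2} with hP₂
  set P₃ : Fin d → Finset (Fin n) → Set Ω := fun j V => {ω |
    (1 : ℝ≥0) * (2 * V.card + 4 * t) < norm2On (fun i => X ω i j) V ^ 2} with hP₃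
  set P₄ : Fin d → Fin d → Set Ω := fun j k =>
    {ω | 1 / (2 * (d + 1)) * (n : ℝ) ≤ |∑ i, X ω i j * X ω i k - n * if j = k then 1 else 0|}
    with hP₄
  have h₁ : μ {ω | ∃ S : Finset (Fin n), S.card = n - c ∧ ω ∈ P₁ S}
      ≤ ENNReal.ofReal (n.choose c * Real.exp (-t)) := by
    rw [← Nat.choose_symm (by omega : c ≤ n)]
    exact measure_exists_card_eq_le P₁ (n - c) fun S _ =>
      measure_exists_lt_sum_mul_le_of_indepFun hε.indep hε.subGaussian hX hXε S ht
  have h₂ : μ {ω | ∃ S : Finset (Fin n), S.card = 2 * c ∧ ω ∈ P₂ S}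
      ≤ ENNReal.ofReal (n.choose (2 * c) * Real.exp (-t)) :=
    measure_exists_card_eq_le P₂ (2 * c) fun V _ =>
      measure_lt_norm2On_sq_le hε.indep hε.subGaussian V t
  have h₃ : ∀ j, μ {ω | ∃ S : Finset (Fin n), S.card = 2 * c ∧ ω ∈ P₃ j S}
      ≤ ENNReal.ofReal (n.choose (2 * c) * Real.exp (-t)) := fun j =>
    measure_exists_card_eq_le (P₃ j) (2 * c) fun V _ =>
      measure_lt_norm2On_sq_le (iIndepFun_column hind j)
        (fun i => hasSubgaussianMGF_entry hlaw i j) V t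
  have h₄ := fun j k => measure_le_abs_sum_mul_sub_le hind hlaw hn j k
    (show (0 : ℝ) < 1 / (2 * (d + 1)) by positivity)
  have hsub : {ω | 4 * (√(σ ^ 2 * (2 * d + 4 * t)) + √2 * √(σ ^ 2 * (2 * (2 * c) + 4 * t))) / √n
      < ‖torrent R (X ω) (response (X ω) β (ε ω) (o ω)) (n - c) - β‖}
      ⊆ {ω | ∃ S : Finset (Fin n), S.card = n - c ∧ ω ∈ P₁ S}
        ∪ {ω | ∃ S : Finset (Fin n), S.card = 2 * c ∧ ω ∈ P₂ S}
        ∪ (⋃ j, {ω | ∃ S : Finset (Fin n), S.card = 2 * c ∧ ω ∈ P₃ j S})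
        ∪ ⋃ j, ⋃ k, P₄ j k := by
    intro ω hω
    by_contra hcon
    simp only [Set.mem_union, Set.mem_iUnion, Set.mem_ofPred_eq, not_or, not_exists, not_and, hP₁,
      hP₂, hP₃, hP₄, not_lt, not_le] at hcon
    obtain ⟨⟨⟨hc1, hc2⟩, hc3⟩, hc4⟩ := hcon
    rw [Set.mem_ofPred_eq] at hω
    refine absurd hω (not_lt.2 ?_)
    refine norm_torrent_sub_le R (X ω) β (ε ω) (o ω) (by omega) hn (Real.sqrt_nonneg _) (hG ω)
      (ho ω) ?_ (fun V hV => Real.le_sqrt_of_sq_le ?_) (fun V hV j => ?_) hκ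
      fun j k => (hc4 j k).le
    · simpa using hc1
    · refine norm2On_sq_le_of_card_eq hcn (fun V hV => ?_) V hV
      have := hc2 V hV
      rw [hV] at this
      push_cast at this
      exact this
    · refine norm2On_sq_le_of_card_eq hcn (fun V hV => ?_) V hV
      have := hc3 j V hV
      rw [hV] at this
      push_cast at this
      linarith
  refine (measure_mono hsub).trans ((measure_union_le _ _).trans (add_le_add
    ((measure_union_le _ _).trans (add_le_add
      ((measure_union_le _ _).trans (add_le_add h₁ h₂)) ?_)) ?_))
  · exact (measure_iUnion_fintype_le _ _).trans (Finset.sum_le_sum fun j _ => h₃ j)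
  · exact (measure_iUnion_fintype_le _ _).trans (Finset.sum_le_sum fun j _ =>
      (measure_iUnion_fintype_le _ _).trans (Finset.sum_le_sum fun k _ => h₄ j k))

/-! ### Asymptotics and consistency. -/

theorem tendsto_max_mul_log_div {c : ℕ → ℕ}
    (hc : (fun n => (c n : ℝ)) =o[atTop] fun n : ℕ => (n : ℝ) / Real.log n) :
    Tendsto (fun n : ℕ => (max (c n) 1 : ℕ) * Real.log n / n) atTop (𝓝 0) := by
  have h1 : Tendsto (fun n : ℕ => (c n : ℝ) / ((n : ℝ) / Real.log n)) atTop (𝓝 0) :=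
    hc.tendsto_div_nhds_zero
  have h2 : Tendsto (fun n : ℕ => Real.log n / (n : ℝ)) atTop (𝓝 0) :=
    (Real.isLittleO_log_id_atTop.tendsto_div_nhds_zero).comp tendsto_natCast_atTop_atTop
  have h3 := h1.add h2
  rw [add_zero] at h3
  refine squeeze_zero' (Eventually.of_forall fun n => ?_) (Eventually.of_forall fun n => ?_) h3
  · have := Real.log_natCast_nonneg n
    positivity
  · have hl := Real.log_natCast_nonneg n
    have hm : ((max (c n) 1 : ℕ) : ℝ) ≤ c n + 1 := by
      exact_mod_cast max_le (Nat.le_succ _) (Nat.le_add_left 1 _)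
    calc (max (c n) 1 : ℕ) * Real.log n / n ≤ (c n + 1) * Real.log n / n := by gcongr
      _ = c n / (n / Real.log n) + Real.log n / n := by rw [div_div_eq_mul_div]; ring

theorem choose_mul_exp_neg_log_le {n k m : ℕ} (hn : 0 < n) (hm : 1 ≤ m) (hk : k ≤ 2 * m) :
    n.choose k * Real.exp (-(3 * (m * Real.log n))) ≤ 1 / n := by
  have hn0 : (0 : ℝ) < n := by exact_mod_cast hn
  have hl := Real.log_natCast_nonneg n
  have hm1 : (1 : ℝ) ≤ m := by exact_mod_cast hm
  have hk2 : (k : ℝ) ≤ 2 * m := by exact_mod_cast hk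
  have h1 : (n.choose k : ℝ) ≤ Real.exp (k * Real.log n) := by
    rw [Real.exp_nat_mul, Real.exp_log hn0]
    exact_mod_cast Nat.choose_le_pow n k
  calc n.choose k * Real.exp (-(3 * (m * Real.log n)))
      ≤ Real.exp (k * Real.log n) * Real.exp (-(3 * (m * Real.log n))) := by gcongr
    _ = Real.exp ((k - 3 * m) * Real.log n) := by rw [← Real.exp_add]; congr 1; ring
    _ ≤ Real.exp (-Real.log n) := Real.exp_le_exp.2 (by nlinarith)
    _ = 1 / n := by rw [Real.exp_neg, Real.exp_log hn0, one_div]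

/-- Consistency of Torrent for standard Gaussian designs. -/
theorem tendstoInMeasure_torrent {d : ℕ} {c : ℕ → ℕ}
    (hc : (fun n => (c n : ℝ)) =o[atTop] fun n : ℕ => (n : ℝ) / Real.log n)
    (R : ∀ n, SortRule n) {Ω : Type*} [MeasurableSpace Ω] {μ : Measure Ω} [IsProbabilityMeasure μ]
    (β : EuclideanSpace ℝ (Fin d)) {X : ∀ n, Ω → Matrix (Fin n) (Fin d) ℝ}
    {ε o : ∀ n, Ω → Fin n → ℝ} {G : ∀ n, Ω → Finset (Fin n)} {σ : ℝ≥0}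
    (hind : ∀ n, iIndepFun
      (fun i ω => (WithLp.toLp 2 (X n ω i) : EuclideanSpace ℝ (Fin d))) μ)
    (hlaw : ∀ n i, HasLaw (fun ω => (WithLp.toLp 2 (X n ω i) : EuclideanSpace ℝ (Fin d)))
      (stdGaussian (EuclideanSpace ℝ (Fin d))) μ)
    (hε : ∀ n, IsSubGaussianNoise (ε n) σ μ)
    (hXε : ∀ n, IndepFun (fun ω i j => X n ω i j) (ε n) μ)
    (hG : ∀ n ω, (G n ω).card ≤ c n) (ho : ∀ n ω, ∀ i ∉ G n ω, o n ω i = 0) :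
    TendstoInMeasure μ
      (fun n ω => torrent (R n) (X n ω) (response (X n ω) β (ε n ω) (o n ω)) (n - c n))
      atTop (fun _ => β) := by
  rw [tendstoInMeasure_iff_norm]
  intro η hη
  have hr := tendsto_max_mul_log_div hc
  -- The maximum with 1 keeps the exponential tail decaying when c n = 0.
  set m : ℕ → ℕ := fun n => max (c n) 1 with hm
  set r : ℕ → ℝ := fun n => (m n : ℝ) * Real.log n / n with hrdef
  replace hr : Tendsto r atTop (𝓝 0) := hr
  set C : Fin d → Fin d → ℝ := fun j k => Var[fun x : EuclideanSpace ℝ (Fin d) => x j * x k;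
    stdGaussian (EuclideanSpace ℝ (Fin d))] / (1 / (2 * (d + 1))) ^ 2 with hC
  have hbound : Tendsto (fun n : ℕ => ENNReal.ofReal (1 / n) + ENNReal.ofReal (1 / n)
      + ∑ _j : Fin d, ENNReal.ofReal (1 / n) + ∑ j, ∑ k, ENNReal.ofReal (C j k / n))
      atTop (𝓝 0) := by
    have h : ∀ a : ℝ, Tendsto (fun n : ℕ => ENNReal.ofReal (a / n)) atTop (𝓝 0) := fun a => by
      simpa using ENNReal.tendsto_ofReal (tendsto_const_div_atTop_nhds_zero_nat a)
    have h' := (((h 1).add (h 1)).add (tendsto_finsetSum Finset.univ fun (_ : Fin d) _ => h 1)).add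
      (tendsto_finsetSum Finset.univ fun (j : Fin d) _ =>
        tendsto_finsetSum Finset.univ fun (k : Fin d) _ => h (C j k))
    simpa using h'
  have hsmall : Tendsto (fun n => 4 * (√(σ ^ 2 * ((2 * d + 12) * r n))
      + √2 * √(σ ^ 2 * (16 * r n)))) atTop (𝓝 0) := by
    have hcont : Continuous fun x : ℝ => 4 * (√((σ : ℝ) ^ 2 * ((2 * d + 12) * x))
      + √2 * √((σ : ℝ) ^ 2 * (16 * x))) := by fun_prop
    have := (hcont.tendsto 0).comp hr
    simpa [Function.comp_def] using this
  refine tendsto_of_tendsto_of_tendsto_of_le_of_le' tendsto_const_nhds hbound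
    (Eventually.of_forall fun n => bot_le) ?_
  have hlog : ∀ᶠ n : ℕ in atTop, 1 ≤ Real.log n :=
    (Real.tendsto_log_atTop.comp tendsto_natCast_atTop_atTop).eventually_ge_atTop 1
  filter_upwards [hlog, eventually_gt_atTop 0, hsmall.eventually_lt_const hη,
    hr.eventually_le_const (show (0 : ℝ) < 1 / 2 by norm_num),
    -- Here 512 = 16 · 32: the squared column norms on small sets are at most 16 r n, and d times
    -- this must not exceed n / 32.
    hr.eventually_le_const (show (0 : ℝ) < 1 / (512 * (d + 1)) by positivity)]
    with n hl hn hs hr2 hrd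
  have hn0 : (0 : ℝ) < n := by exact_mod_cast hn
  have hrn : (m n : ℝ) * Real.log n = r n * n := by rw [hrdef]; field_simp
  have hm1 : (1 : ℝ) ≤ m n := by exact_mod_cast le_max_right _ _
  have hcm : (c n : ℝ) ≤ m n := by exact_mod_cast le_max_left _ _
  have hml : (m n : ℝ) ≤ m n * Real.log n := le_mul_of_one_le_right (by positivity) hl
  -- At most n^(2m) sets enter each union bound, so exp(-t) = n^(-3m) leaves at most 1/n, while t/n
  -- = 3 r n still tends to zero because r does (here r is evaluated at n).
  set t : ℝ := 3 * (m n * Real.log n) with ht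
  have hcn : 2 * c n ≤ n := by
    have : (2 * c n : ℝ) ≤ n := by nlinarith
    exact_mod_cast this
  have hκ : d * (2 * (2 * c n) + 4 * t) ≤ (n : ℝ) / 32 := by
    rw [le_div_iff₀ (by positivity)] at hrd
    have h1 : 2 * (2 * (c n : ℝ)) + 4 * t ≤ 16 * (r n * n) := by rw [ht, hrn]; linarith
    have h2 : (d : ℝ) * (2 * (2 * c n) + 4 * t) ≤ d * (16 * (r n * n)) := by gcongr
    have h3 : 0 ≤ r n := by rw [hrdef]; positivity
    have h4 : r n * (512 * (d + 1)) * n ≤ 1 * n := by gcongr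
    nlinarith [mul_nonneg h3 hn0.le]
  have hmain := measure_lt_norm_torrent_sub_le hcn hn (R n) β (hind n) (hlaw n) (hε n) (hXε n)
    (hG n) (ho n) (t := t) (by positivity) hκ
  have hthr : 4 * (√((σ : ℝ) ^ 2 * (2 * d + 4 * t))
      + √2 * √((σ : ℝ) ^ 2 * (2 * (2 * c n) + 4 * t))) / √n < η := by
    refine lt_of_le_of_lt ?_ hs
    rw [mul_div_assoc, add_div, mul_div_assoc, ← Real.sqrt_div (by positivity),
      ← Real.sqrt_div (by positivity), mul_div_assoc, mul_div_assoc]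
    have h1 : (2 * d + 4 * t) / n ≤ (2 * d + 12) * r n := by
      rw [div_le_iff₀ hn0, mul_assoc, ← hrn, ht]
      have : (d : ℝ) * 1 ≤ d * (m n * Real.log n) := by gcongr; linarith
      linarith
    have h2 : (2 * (2 * c n) + 4 * t) / n ≤ 16 * r n := by
      rw [div_le_iff₀ hn0, mul_assoc, ← hrn, ht]
      linarith
    gcongr
  refine (measure_mono fun ω hω => ?_).trans (hmain.trans ?_)
  · rw [Set.mem_ofPred_eq] at hω ⊢
    exact hthr.trans_le hω
  · have h1 : n.choose (c n) * Real.exp (-t) ≤ 1 / n :=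
      choose_mul_exp_neg_log_le hn (le_max_right _ _)
        ((le_max_left (c n) 1).trans (Nat.le_mul_of_pos_left _ two_pos))
    have h2 : n.choose (2 * c n) * Real.exp (-t) ≤ 1 / n :=
      choose_mul_exp_neg_log_le hn (le_max_right _ _)
        (Nat.mul_le_mul_left 2 (le_max_left (c n) 1))
    gcongr

end Torrent
theorem corollary3p4 :
    -- the error bound
    (∃ K : ℝ, 0 < K ∧
      ∀ (n d c : ℕ) (_ : 1 ≤ c) (_ : 2 * c < n) (R : Torrent.SortRule n)
        (Ω : Type u) [MeasurableSpace Ω] (μ : Measure Ω) [IsProbabilityMeasure μ]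
        (β : EuclideanSpace ℝ (Fin d)) (X : Ω → Matrix (Fin n) (Fin d) ℝ)
        (ε o : Ω → Fin n → ℝ) (G : Ω → Finset (Fin n)) (σ : ℝ≥0)
        (_ : AEMeasurable (fun ω i j => X ω i j) μ)
        (_ : Torrent.IsSubGaussianNoise ε σ μ)
        (_ : IndepFun (fun ω i j => X ω i j) ε μ)
        (_ : ∀ ω, (G ω).card ≤ c)
        (_ : ∀ ω, ∀ i ∉ G ω, o ω i = 0)
        (_ : ∀ᵐ ω ∂μ, Torrent.EtaCondition (X ω) (G ω) (n - c))
        (δ : ℝ) (_ : 0 < δ),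
        ∃ E : Set Ω, MeasurableSet E ∧ 1 - δ ≤ μ.real E ∧ ∀ ω ∈ E,
          ‖Torrent.torrent R (X ω) (Torrent.response (X ω) β (ε ω) (o ω)) (n - c) - β‖
            ≤ Torrent.errorBound K σ (Torrent.eta (X ω) (G ω) (n - c))
                (Torrent.lam (X ω) (n - c)) δ n d c) ∧
    -- consistency for standard Gaussian designs
    (∀ (d : ℕ) (c : ℕ → ℕ)
      (_ : (fun n => (c n : ℝ)) =o[atTop] fun n : ℕ => (n : ℝ) / Real.log n)
      (R : ∀ n, Torrent.SortRule n)
      (Ω : Type v) [MeasurableSpace Ω] (μ : Measure Ω) [IsProbabilityMeasure μ]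
      (β : EuclideanSpace ℝ (Fin d)) (X : ∀ n, Ω → Matrix (Fin n) (Fin d) ℝ)
      (ε o : ∀ n, Ω → Fin n → ℝ) (G : ∀ n, Ω → Finset (Fin n)) (σ : ℝ≥0)
      (_ : ∀ n, iIndepFun (fun i ω => (WithLp.toLp 2 (X n ω i) : EuclideanSpace ℝ (Fin d))) μ)
      (_ : ∀ n i, HasLaw (fun ω => (WithLp.toLp 2 (X n ω i) : EuclideanSpace ℝ (Fin d)))
        (stdGaussian (EuclideanSpace ℝ (Fin d))) μ)
      (_ : ∀ n, Torrent.IsSubGaussianNoise (ε n) σ μ)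
      (_ : ∀ n, IndepFun (fun ω i j => X n ω i j) (ε n) μ)
      (_ : ∀ n ω, (G n ω).card ≤ c n)
      (_ : ∀ n ω, ∀ i ∉ G n ω, o n ω i = 0),
      TendstoInMeasure μ
        (fun n ω => Torrent.torrent (R n) (X n ω)
          (Torrent.response (X n ω) β (ε n ω) (o n ω)) (n - c n))
        atTop (fun _ => β)) := by
  refine ⟨⟨9, by norm_num, ?_⟩, ?_⟩
  · intro n d c hc hcn R Ω _ μ _ β X ε o G σ hX hε hXε hG ho hη δ hδ
    exact Torrent.exists_measurableSet_norm_torrent_sub_le hc hcn R β hX hε hXε hG ho hη hδ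
  · intro d c hc R Ω _ μ _ β X ε o G σ hind hlaw hε hXε hG ho
    exact Torrent.tendstoInMeasure_torrent hc R β hind hlaw hε hXε hG ho
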